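/- Let $m\ge 1$ be an integer and, for $1\le s\le m$, let $w_s(x)=e^{\gamma_s x}r_s(x)$ with $\gamma_s\in\mathbb{R}$ and $r_s\in C^{m-s}(\mathbb{R})$ strictly positive and $1$-periodic. For $k\in\mathbb{Z}$ let $\mathcal{U}_m$ be the complex span of the functions $$u_1=w_1,\qquad u_\ell(x)=w_1(x)\int_k^x w_2(x_2)\int_k^{x_2}w_3(x_3)\cdots\int_k^{x_{\ell-1}}w_\ell(x_\ell)\,dx_\ell\cdots dx_2\qquad(2\le \ell\le m).$$ A *PEB-spline* (periodic exponential B-spline) of order $m$ is a function $\varphi:\mathbb{R}\to\mathbb{C}$ for which there are such weights $w_1,\dots,w_m$ and a $k\in\mathbb{Z}$ such that $\operatorname{supp}\varphi=[k,k+m]$, on each interval $(k+i,k+i+1)$, $0\le i<m$, $\varphi$ coincides with an element of $\mathcal{U}_m$, and $\varphi\in C^{m-2}(\mathbb{R})$ if $m\ge2$, while $\varphi$ is right-continuous if $m=1$. For $p\in[1,\infty]$ let $V^p(\varphi)$ be the set of all $f\in L^p(\mathbb{R})$ of the form $$f(x)=\sum_{\ell\in\mathbb{Z}}c_\ell\,\varphi(x-\ell)\quad(x\in\mathbb{R}),\qquad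 (c_\ell)_{\ell\in\mathbb{Z}}\in\ell^p(\mathbb{Z}).$$ Let $\varphi$ be a PEB-spline of any order $m\ge1$, and let $X=\{x_j: j\in\mathbb{Z}\}\subseteq\mathbb{R}$ with $x_j<x_{j+1}$ for all $j\in\mathbb{Z}$ be separated, i.e. $\inf_{x,y\in X,\,x\ne y}|x-y|>0$, with maximum gap $$\mathfrak{mg}(X):=\sup_{j\in\mathbb{Z}}(x_{j+1}-x_j)<1.$$ Then, for every $p\in[1,\infty]$, $X$ is a sampling set for $V^p(\varphi)$: there are constants $A,B>0$ such that for all $f\in V^p(\varphi)$ $$A\|f\|_{L^p}^p\le\sum_{x\in X}|f(x)|^p\le B\|f\|_{L^p}^p\quad\text{if }p<\infty,\qquad A\|f\|_{L^\infty}\le\sup_{x\in X}|f(x)|\le B\|f\|_{L^\infty}\quad\text{if }p=\infty.$$ -/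

import Mathlib

open MeasureTheory Set
open scoped ENNReal

noncomputable section

namespace PEB

/-- Iterated integrals of weights with base point `a`: `iterInt w a s 0 = w s` and
`iterInt w a s (n + 1) x = w s x * ∫ t in a..x, iterInt w a (s + 1) n t`, i.e.
`w_s(x) ∫_a^x w_{s+1}(x_{s+1}) ∫_a^{x_{s+1}} ⋯ w_{s+n}(x_{s+n}) dx_{s+n} ⋯ dx_{s+1}`. -/
def iterInt (w : ℕ → ℝ → ℝ) (a : ℝ) : ℕ → ℕ → ℝ → ℝ
  | s, 0 => w s
  | s, n + 1 => fun x => w s x * ∫ t in a..x, iterInt w a (s + 1) n t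

/-- The member `u_ℓ` (`1 ≤ ℓ`) of the extended complete Chebyshev system with weights
`w 1, w 2, …` and base point `a`. -/
def eccFun (w : ℕ → ℝ → ℝ) (a : ℝ) (ℓ : ℕ) : ℝ → ℝ :=
  iterInt w a 1 (ℓ - 1)

/-- The ECC-space, i.e. the complex span of `u_1, …, u_m`. -/
def eccSpace (w : ℕ → ℝ → ℝ) (a : ℝ) (m : ℕ) : Submodule ℂ (ℝ → ℂ) :=
  Submodule.span ℂ {g | ∃ ℓ ∈ Finset.Icc 1 m, g = fun x => (eccFun w a ℓ x : ℂ)}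

/-- Periodic exponential weights: for `1 ≤ s ≤ m`, `w s x = exp (γ x) * r x` with `γ` real and
`r` a strictly positive `1`-periodic function of class `C^{m-s}`
(both depending on `s`). -/
def IsPEBWeights (m : ℕ) (w : ℕ → ℝ → ℝ) : Prop :=
  ∀ s ∈ Finset.Icc 1 m, ∃ (γ : ℝ) (r : ℝ → ℝ),
    ContDiff ℝ ((m - s : ℕ) : WithTop ℕ∞) r ∧ Function.Periodic r 1 ∧ (∀ x, 0 < r x) ∧
      ∀ x, w s x = Real.exp (γ * x) * r x

/-- `φ` is a periodic exponential B-spline of order `m`: the Chebyshev B-spline, in any nonzero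
normalization, for periodic exponential weights and consecutive integer knots `k, …, k + m`.
Thus it is of class `C^{m-2}` (no condition if `m = 1`), it lies in the ECC-space between
consecutive knots, and its support is `[k, k + m]`. At a discontinuity, which occurs only for
`m = 1`, its value is the limit from the right. -/
def IsPEBSpline (m : ℕ) (φ : ℝ → ℂ) : Prop :=
  ∃ (w : ℕ → ℝ → ℝ) (k : ℤ), IsPEBWeights m w ∧
    (2 ≤ m → ContDiff ℝ ((m - 2 : ℕ) : WithTop ℕ∞) φ) ∧
    (∀ x, ContinuousWithinAt φ (Ici x) x) ∧
    (∀ i < m, ∃ u ∈ eccSpace w k m, EqOn φ u (Ioo ((k : ℝ) + i) ((k : ℝ) + i + 1))) ∧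
    tsupport φ = Icc (k : ℝ) ((k : ℝ) + m)

/-- The shift-invariant space `V^p(φ)`: functions in `L^p(ℝ)` of the form
`f(x) = ∑_ℓ c_ℓ φ(x - ℓ)` for every `x`, with `c ∈ ℓ^p(ℤ)`. -/
def shiftInvariantSpace (p : ℝ≥0∞) (φ : ℝ → ℂ) : Set (ℝ → ℂ) :=
  {f | MemLp f p volume ∧ ∃ c : ℤ → ℂ, Memℓp c p ∧
    ∀ x, HasSum (fun ℓ : ℤ => c ℓ * φ (x - ℓ)) (f x)}

/-- `X` is a sampling set (without derivatives) for a space `V` of functions with respect to the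
`L^p`-norm. -/
def IsSamplingSet (p : ℝ≥0∞) (V : Set (ℝ → ℂ)) (X : Set ℝ) : Prop :=
  ∃ A B : ℝ, 0 < A ∧ 0 < B ∧ ∀ f ∈ V,
    (p ≠ ∞ →
      ENNReal.ofReal A * eLpNorm f p volume ^ p.toReal ≤ (∑' x : X, ‖f x‖ₑ ^ p.toReal) ∧
      (∑' x : X, ‖f x‖ₑ ^ p.toReal) ≤ ENNReal.ofReal B * eLpNorm f p volume ^ p.toReal) ∧
    (p = ∞ →
      ENNReal.ofReal A * eLpNorm f ∞ volume ≤ (⨆ x : X, ‖f x‖ₑ) ∧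
      (⨆ x : X, ‖f x‖ₑ) ≤ ENNReal.ofReal B * eLpNorm f ∞ volume)

/-- `X` is separated: distinct points have a distance bounded below by a positive constant. -/
def IsSeparatedSet (X : Set ℝ) : Prop :=
  ∃ δ : ℝ, 0 < δ ∧ X.Pairwise fun x y => δ ≤ |x - y|

/-- The maximum gap `sup_j (x_{j+1} - x_j)` of an increasing sequence, with values in `[0, ∞]`. -/
def maxGap (x : ℤ → ℝ) : ℝ≥0∞ :=
  ⨆ j : ℤ, ENNReal.ofReal (x (j + 1) - x j)

end PEB

end

/-! The samples of `f`, its coefficients `c` and its `L^p` norm all control one another. The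
decisive step is to bound a single coefficient by the samples in a window of fixed length, with a
constant that depends neither on the window nor on `X`.

A spline is a positive weight times a primitive of a spline with one weight fewer. Rolle's theorem,
iterated along this recursion, bounds the number of sign changes between two knots
(`IsSpline.signChanges_le`), and a spline that vanishes beyond an end knot satisfies a sharper
bound. Hence a spline with too short a support is zero, which makes the shifts of the generator
locally linearly independent (`IsGenerator.coeff_eq_zero`). Moreover, a spline with more zeros in
`N` cells than there are shifts active there must vanish on some cell; a zero inside each cell
carries this to the neighbours (`IsSpline.eq_zero_of_zeros`). A gap below `1` supplies both kinds of
zeros in a long enough window, so vanishing samples force vanishing coefficients. Compactness of the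
admissible sample positions turns this uniqueness into a uniform inequality
(`IsGenerator.local_bound`).

Integer translations only rescale periodic exponential weights, so the inequality holds for every
coefficient, and summing over windows of bounded overlap gives `IsGenerator.tsum_coeff_le`. The
estimates of samples and integrals by coefficients use only boundedness, compact support and, for
the samples, separation. The bound of coefficients by the integral comes from the sampling
inequality itself, applied to the lattices `t + ℤ/2` and averaged over `t`. -/

open scoped NNReal

namespace PEB

/-! ### Chebyshevian splines: sign changes and zeros. -/

section Spline

/-! ### Real splines with integer knots -/

/-- The weights `w s, …, w (s + n)` are continuous and positive. -/
def PosWeights (w : ℕ → ℝ → ℝ) (s n : ℕ) : Prop :=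
  ∀ j, s ≤ j → j ≤ s + n → Continuous (w j) ∧ ∀ x, 0 < w j x

lemma PosWeights.head {w : ℕ → ℝ → ℝ} {s n : ℕ} (h : PosWeights w s n) :
    Continuous (w s) ∧ ∀ x, 0 < w s x := h s le_rfl (by omega)

lemma PosWeights.tail {w : ℕ → ℝ → ℝ} {s n : ℕ} (h : PosWeights w s (n + 1)) :
    PosWeights w (s + 1) n := fun j h1 h2 => h j (by omega) (by omega)

/-- Chebyshevian splines with simple integer knots for the weights `w s, …, w (s + n)`. -/
def IsSpline (w : ℕ → ℝ → ℝ) : ℕ → ℕ → (ℝ → ℝ) → Prop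
  | s, 0, f => ∃ c : ℤ → ℝ, ∀ x, f x = w s x * c ⌊x⌋
  | s, n + 1, f => ∃ F g : ℝ → ℝ, IsSpline w (s + 1) n g ∧ (∀ x, f x = w s x * F x) ∧
      ∀ x y, F y - F x = ∫ t in x..y, g t

variable {w : ℕ → ℝ → ℝ} {s n : ℕ} {f g F : ℝ → ℝ}

lemma continuousWithinAt_floor_comp (c : ℤ → ℝ) (x : ℝ) :
    ContinuousWithinAt (fun y : ℝ => c ⌊y⌋) (Ici x) x := by
  refine (continuousWithinAt_const (b := c ⌊x⌋) (x := x)).congr_of_eventuallyEq ?_ rfl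
  have : ∀ᶠ y : ℝ in nhdsWithin x (Ici x), y < ⌊x⌋ + 1 :=
    mem_nhdsWithin_of_mem_nhds (Iio_mem_nhds (Int.lt_floor_add_one x))
  filter_upwards [this, self_mem_nhdsWithin] with y h1 h2
  have : ⌊y⌋ = ⌊x⌋ := Int.floor_eq_iff.2 ⟨(Int.floor_le x).trans h2, h1⟩
  simp [this]

lemma exists_floor_comp_bound (c : ℤ → ℝ) (a b : ℝ) :
    ∃ C, ∀ x ∈ Icc a b, |c ⌊x⌋| ≤ C := by
  obtain ⟨C, hC⟩ := ((Finset.Icc ⌊a⌋ ⌊b⌋).image fun i => |c i|).exists_le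
  exact ⟨C, fun x hx => hC _ (Finset.mem_image_of_mem _ (Finset.mem_Icc.2
    ⟨Int.floor_le_floor hx.1, Int.floor_le_floor hx.2⟩))⟩

lemma intervalIntegrable_floor_comp (c : ℤ → ℝ) {v : ℝ → ℝ} (hv : Continuous v) (a b : ℝ) :
    IntervalIntegrable (fun y : ℝ => v y * c ⌊y⌋) volume a b := by
  refine IntervalIntegrable.continuousOn_mul ?_ hv.continuousOn
  rw [intervalIntegrable_iff]
  obtain ⟨C, hC⟩ := exists_floor_comp_bound c (min a b) (max a b)
  refine Measure.integrableOn_of_bounded (M := C) (by simp)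
    ((measurable_from_top (f := c)).comp Int.measurable_floor).aestronglyMeasurable ?_
  exact (ae_restrict_iff' measurableSet_uIoc).2 (Filter.Eventually.of_forall fun x hx =>
    hC x ⟨hx.1.le, hx.2⟩)

lemma continuous_of_increment (hg : ∀ a b, IntervalIntegrable g volume a b)
    (h : ∀ x y, F y - F x = ∫ t in x..y, g t) : Continuous F := by
  have : F = fun y => F 0 + ∫ t in (0 : ℝ)..y, g t := by
    ext y; rw [← h 0 y]; ring
  rw [this]
  exact continuous_const.add (intervalIntegral.continuous_primitive hg 0)

lemma IsSpline.intervalIntegrable (hw : PosWeights w s n) (hf : IsSpline w s n f) (a b : ℝ) :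
    IntervalIntegrable f volume a b := by
  induction n generalizing s f a b with
  | zero =>
    obtain ⟨c, hc⟩ := hf
    rw [funext hc]
    exact intervalIntegrable_floor_comp c hw.head.1 a b
  | succ n ih =>
    obtain ⟨F, g, hg, h1, h2⟩ := hf
    rw [funext h1]
    exact (hw.head.1.mul (continuous_of_increment (fun a b => ih hw.tail hg a b) h2)
      ).intervalIntegrable a b

lemma IsSpline.continuous (hw : PosWeights w s (n + 1)) (hf : IsSpline w s (n + 1) f) :
    Continuous f := by
  obtain ⟨F, g, hg, h1, h2⟩ := hf
  rw [funext h1]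
  exact hw.head.1.mul (continuous_of_increment (hg.intervalIntegrable hw.tail) h2)

lemma IsSpline.continuousWithinAt (hw : PosWeights w s n) (hf : IsSpline w s n f) (x : ℝ) :
    ContinuousWithinAt f (Ici x) x := by
  cases n with
  | zero =>
    obtain ⟨c, hc⟩ := hf
    rw [funext hc]
    exact hw.head.1.continuousWithinAt.mul (continuousWithinAt_floor_comp c x)
  | succ n => exact (hf.continuous hw).continuousWithinAt

lemma IsSpline.exists_bound (hw : PosWeights w s n) (hf : IsSpline w s n f) (a b : ℝ) :
    ∃ C, ∀ x ∈ Icc a b, |f x| ≤ C := by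
  cases n with
  | zero =>
    obtain ⟨c, hc⟩ := hf
    obtain ⟨C, hC⟩ := exists_floor_comp_bound c a b
    obtain ⟨D, hD⟩ := isCompact_Icc.exists_bound_of_continuousOn
      (hw.head.1.continuousOn (s := Icc a b))
    refine ⟨D * C, fun x hx => ?_⟩
    rw [hc, abs_mul]
    exact mul_le_mul (hD x hx) (hC x hx) (abs_nonneg _) ((norm_nonneg _).trans (hD x hx))
  | succ n => exact isCompact_Icc.exists_bound_of_continuousOn (hf.continuous hw).continuousOn

lemma isSpline_zero : IsSpline w s n (fun _ => 0) := by
  induction n generalizing s with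
  | zero => exact ⟨0, by simp⟩
  | succ n ih => exact ⟨0, _, ih, by simp, by simp⟩

lemma IsSpline.const_mul (c : ℝ) (hf : IsSpline w s n f) :
    IsSpline w s n (fun x => c * f x) := by
  induction n generalizing s f with
  | zero =>
    obtain ⟨d, hd⟩ := hf
    exact ⟨fun i => c * d i, fun x => by simp only [hd]; ring⟩
  | succ n ih =>
    obtain ⟨F, g, hg, h1, h2⟩ := hf
    refine ⟨fun x => c * F x, _, ih hg, fun x => by simp only [h1]; ring, fun x y => ?_⟩
    rw [intervalIntegral.integral_const_mul, ← h2]; ring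

lemma IsSpline.add (hw : PosWeights w s n) {f₁ f₂ : ℝ → ℝ} (hf₁ : IsSpline w s n f₁)
    (hf₂ : IsSpline w s n f₂) : IsSpline w s n (fun x => f₁ x + f₂ x) := by
  induction n generalizing s f₁ f₂ with
  | zero =>
    obtain ⟨c, hc⟩ := hf₁
    obtain ⟨d, hd⟩ := hf₂
    exact ⟨fun i => c i + d i, fun x => by simp only [hc, hd]; ring⟩
  | succ n ih =>
    obtain ⟨F, g, hg, h1, h2⟩ := hf₁
    obtain ⟨G, k, hk, h3, h4⟩ := hf₂
    refine ⟨fun x => F x + G x, _, ih hw.tail hg hk, fun x => by simp only [h1, h3]; ring,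
      fun x y => ?_⟩
    rw [intervalIntegral.integral_add (hg.intervalIntegrable hw.tail _ _)
      (hk.intervalIntegrable hw.tail _ _), ← h2, ← h4]; ring

/-- Integer shifts preserve splines if they only rescale the weights. -/
lemma IsSpline.comp_sub_int (hf : IsSpline w s n f) (l : ℤ)
    (hl : ∀ j, s ≤ j → j ≤ s + n → ∃ κ : ℝ, ∀ x, w j (x - l) = κ * w j x) :
    IsSpline w s n (fun x => f (x - l)) := by
  induction n generalizing s f with
  | zero =>
    obtain ⟨c, hc⟩ := hf
    obtain ⟨κ, hκ⟩ := hl s le_rfl le_rfl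
    exact ⟨fun i => κ * c (i - l), fun x => by simp only [hc, hκ, Int.floor_sub_intCast]; ring⟩
  | succ n ih =>
    obtain ⟨F, g, hg, h1, h2⟩ := hf
    obtain ⟨κ, hκ⟩ := hl s le_rfl (by omega)
    refine ⟨fun x => κ * F (x - l), _,
      (ih hg fun j h1 h2 => hl j (by omega) (by omega)).const_mul κ,
      fun x => by simp only [h1, hκ]; ring, fun x y => ?_⟩
    rw [intervalIntegral.integral_const_mul, intervalIntegral.integral_comp_sub_right g, ← h2]
    ring

/-! ### Vanishing on intervals -/

/-- The right derivative of the primitive of a right-continuous function is that function itself.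
Right continuity is what gives vanishing at every point, knots included, instead of almost
everywhere. -/
lemma eq_zero_of_increment (hg : ∀ a b, IntervalIntegrable g volume a b)
    (hc : ∀ x, ContinuousWithinAt g (Ici x) x)
    (h : ∀ x y, F y - F x = ∫ t in x..y, g t) {u v : ℝ} (hF : ∀ x ∈ Ioo u v, F x = 0) :
    ∀ x ∈ Ioo u v, g x = 0 := by
  intro x hx
  have hm : StronglyMeasurableAtFilter g (nhdsWithin x (Ioi x)) volume :=
    ⟨Ioc x (x + 1), Ioc_mem_nhdsGT (by linarith), (hg x (x + 1)).1.aestronglyMeasurable⟩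
  have h1 : HasDerivWithinAt (fun y => ∫ t in x..y, g t) (g x) (Ici x) x :=
    intervalIntegral.integral_hasDerivWithinAt_right (hg x x) hm
      ((hc x).mono Ioi_subset_Ici_self)
  have h2 : HasDerivWithinAt (fun y => ∫ t in x..y, g t) 0 (Ici x) x := by
    refine (hasDerivWithinAt_const x (Ici x) (0 : ℝ)).congr_of_eventuallyEq ?_ (by simp)
    have : ∀ᶠ y in nhdsWithin x (Ici x), y ∈ Ioo u v :=
      mem_nhdsWithin_of_mem_nhds (isOpen_Ioo.mem_nhds hx)
    filter_upwards [this] with y hy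
    rw [← h, hF y hy, hF x hx, sub_zero]
  exact (uniqueDiffWithinAt_Ici x).eq_deriv _ h1 h2

lemma IsSpline.exists_vanishing (hw : PosWeights w s (n + 1)) (hg : IsSpline w (s + 1) n g)
    (h1 : ∀ x, f x = w s x * F x) (h2 : ∀ x y, F y - F x = ∫ t in x..y, g t) {u v : ℝ}
    (hf : ∀ x ∈ Ioo u v, f x = 0) :
    (∀ x ∈ Ioo u v, F x = 0) ∧ ∀ x ∈ Ioo u v, g x = 0 := by
  have hF : ∀ x ∈ Ioo u v, F x = 0 := fun x hx => by
    have := hf x hx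
    rw [h1] at this
    exact (mul_eq_zero.1 this).resolve_left (hw.head.2 x).ne'
  exact ⟨hF, eq_zero_of_increment (hg.intervalIntegrable hw.tail)
    (hg.continuousWithinAt hw.tail) h2 hF⟩

/-- A spline vanishing on a nonempty open subinterval of a cell vanishes on the cell. -/
lemma IsSpline.eq_zero_on_cell (hw : PosWeights w s n) (hf : IsSpline w s n f) {i : ℤ} {u v : ℝ}
    (huv : u < v) (hu : (i : ℝ) ≤ u) (hv : v ≤ i + 1) (h0 : ∀ x ∈ Ioo u v, f x = 0) :
    ∀ x ∈ Ioo (i : ℝ) (i + 1), f x = 0 := by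
  have hmid : (u + v) / 2 ∈ Ioo u v := ⟨by linarith, by linarith⟩
  induction n generalizing s f with
  | zero =>
    obtain ⟨c, hc⟩ := hf
    intro x hx
    have e1 : ⌊x⌋ = i := Int.floor_eq_iff.2 ⟨hx.1.le, hx.2⟩
    have e2 : ⌊(u + v) / 2⌋ = i := Int.floor_eq_iff.2 ⟨by linarith, by linarith⟩
    have := h0 _ hmid
    rw [hc, e2] at this
    rw [hc, e1, (mul_eq_zero.1 this).resolve_left (hw.head.2 _).ne', mul_zero]
  | succ n ih =>
    obtain ⟨F, g, hg, h1, h2⟩ := hf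
    obtain ⟨hF, hg0⟩ := IsSpline.exists_vanishing hw hg h1 h2 h0
    have hgi := ih hw.tail hg hg0
    intro x hx
    -- By induction `g` vanishes on the whole cell, so `F` is constant there, and it is zero at the
    -- midpoint.
    have : F x - F ((u + v) / 2) = 0 := by
      rw [h2, intervalIntegral.integral_congr (g := fun _ => (0 : ℝ)), intervalIntegral.integral_zero]
      intro t ht
      refine hgi t ?_
      have := (ordConnected_Ioo (a := (i : ℝ)) (b := (i : ℝ) + 1)).uIcc_subset
        ⟨by linarith, by linarith⟩ hx ht
      exact this
    rw [h1, ← sub_add_cancel (F x) (F ((u + v) / 2)), this, hF _ hmid]; simp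

/-! ### Sign changes -/

/-- `f` has at least `K` strong sign changes on `S`. -/
def AltOn (f : ℝ → ℝ) (S : Set ℝ) (K : ℕ) : Prop :=
  ∃ (t : ℕ → ℝ) (σ : ℝ), (∀ i ≤ K, t i ∈ S) ∧ (∀ i < K, t i < t (i + 1)) ∧
    ∀ i ≤ K, 0 < σ * (-1) ^ i * f (t i)

lemma exists_pos_of_integral_pos {x y : ℝ} (hxy : x < y) (h : 0 < ∫ t in x..y, g t) :
    ∃ t ∈ Ioo x y, 0 < g t := by
  by_contra! hcon
  rw [intervalIntegral.integral_of_le hxy.le, integral_Ioc_eq_integral_Ioo] at h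
  exact absurd h (not_lt.2 (setIntegral_nonpos measurableSet_Ioo hcon))

lemma exists_pos_of_increment (h : ∀ x y, F y - F x = ∫ t in x..y, g t) (c : ℝ) {x y : ℝ}
    (hxy : x < y) (hF : 0 < c * (F y - F x)) : ∃ t ∈ Ioo x y, 0 < c * g t := by
  rw [h, ← intervalIntegral.integral_const_mul] at hF
  exact exists_pos_of_integral_pos hxy hF

/-- Rolle's theorem for sign changes. -/
lemma altOn_of_increments (h : ∀ x y, F y - F x = ∫ t in x..y, g t) {a b σ : ℝ} {K : ℕ}
    (t : ℕ → ℝ) (hS : ∀ i ≤ K + 1, t i ∈ Icc a b) (ht : ∀ i ≤ K, t i < t (i + 1))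
    (hinc : ∀ i ≤ K, 0 < σ * (-1) ^ i * (F (t (i + 1)) - F (t i))) : AltOn g (Ioo a b) K := by
  have : ∀ i, ∃ z, i ≤ K → z ∈ Ioo (t i) (t (i + 1)) ∧ 0 < σ * (-1) ^ i * g z := fun i => by
    by_cases hi : i ≤ K
    · obtain ⟨z, hz, hz'⟩ := exists_pos_of_increment h _ (ht i hi) (hinc i hi)
      exact ⟨z, fun _ => ⟨hz, hz'⟩⟩
    · exact ⟨0, fun h => absurd h hi⟩
  choose z hz using this
  refine ⟨z, σ, fun i hi => ?_, fun i hi => ?_, fun i hi => (hz i hi).2⟩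
  · exact ⟨(hS i (by omega)).1.trans_lt (hz i hi).1.1,
      (hz i hi).1.2.trans_le (hS (i + 1) (by omega)).2⟩
  · exact (hz i hi.le).1.2.trans (hz (i + 1) hi).1.1

lemma eq_zero_of_tendsto_left (hF : Continuous F) {u a : ℝ} (hu : u < a)
    (h : ∀ x ∈ Ioo u a, F x = 0) : F a = 0 := by
  have h1 : closure (Ioo u a) ⊆ {x | F x = 0} :=
    closure_minimal h (isClosed_eq hF continuous_const)
  rw [closure_Ioo hu.ne] at h1
  exact h1 (right_mem_Icc.2 hu.le)

lemma eq_zero_of_tendsto_right (hF : Continuous F) {u a : ℝ} (hu : a < u)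
    (h : ∀ x ∈ Ioo a u, F x = 0) : F a = 0 := by
  have h1 : closure (Ioo a u) ⊆ {x | F x = 0} :=
    closure_minimal h (isClosed_eq hF continuous_const)
  rw [closure_Ioo hu.ne] at h1
  exact h1 (left_mem_Icc.2 hu.le)

/-- Dividing by the positive weight keeps all signs, so `F` alternates with `f`. Rolle loses one
sign change, and each endpoint where `F` vanishes gives one back, since the step between that zero
and the nearest sample is a further alternating increment. -/
lemma altOn_derivative (hw : ∀ x, 0 < w s x) (h1 : ∀ x, f x = w s x * F x)
    (h2 : ∀ x y, F y - F x = ∫ t in x..y, g t) {a b : ℝ} {K : ℕ} (l r : Bool)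
    (hl : l = true → F a = 0) (hr : r = true → F b = 0) (h : AltOn f (Ioo a b) K) (J : ℕ)
    (hJ : J + 1 = K + l.toNat + r.toNat) : AltOn g (Ioo a b) J := by
  obtain ⟨t, σ, hS, ht, hsgn⟩ := h
  have hF : ∀ i ≤ K, 0 < σ * (-1) ^ i * F (t i) := fun i hi => by
    have := hsgn i hi
    rw [h1, show σ * (-1) ^ i * (w s (t i) * F (t i)) = w s (t i) * (σ * (-1) ^ i * F (t i)) by
      ring] at this
    exact pos_of_mul_pos_right this (hw _).le
  have hab : a < b := (hS 0 (by omega)).1.trans (hS 0 (by omega)).2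
  -- The list `a, t 0, …, t K, b`. Increments `1` to `K` are always usable; increments `0` and `K +
  -- 1` need the zero at the corresponding end.
  let τ : ℕ → ℝ := fun i => if i = 0 then a else if i ≤ K + 1 then t (i - 1) else b
  have hτ0 : τ 0 = a := by simp [τ]
  have hτ1 : ∀ i ≤ K, τ (i + 1) = t i := fun i hi => by simp [τ, hi]
  have hτ2 : τ (K + 2) = b := by simp [τ]
  have hτS : ∀ i, τ i ∈ Icc a b := fun i => by
    by_cases h0 : i = 0
    · simp [τ, h0, hab.le]
    · by_cases h3 : i ≤ K + 1
      · simpa [τ, h0, h3] using Ioo_subset_Icc_self (hS (i - 1) (by omega))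
      · simp [τ, h0, h3, hab.le]
  have hτlt : ∀ i ≤ K + 1, τ i < τ (i + 1) := fun i hi => by
    rcases Nat.eq_zero_or_pos i with rfl | hpos
    · rw [hτ0, hτ1 0 (by omega)]; exact (hS 0 (by omega)).1
    · obtain ⟨i, rfl⟩ := Nat.exists_eq_add_of_lt hpos
      rw [zero_add] at hi ⊢
      rw [hτ1 i (by omega)]
      rcases Nat.lt_or_ge i K with h | h
      · rw [hτ1 (i + 1) h]; exact ht i h
      · have : i = K := by omega
        subst this
        rw [hτ2]; exact (hS i le_rfl).2
  have inc0 : l = true → 0 < σ * (-1) ^ 0 * (F (τ (0 + 1)) - F (τ 0)) := fun h => by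
    rw [hτ0, hl h, hτ1 0 (by omega), sub_zero]; exact hF 0 (by omega)
  have inc1 : ∀ i < K, 0 < σ * (-1) ^ (i + 1) * (F (τ (i + 1 + 1)) - F (τ (i + 1))) :=
    fun i hi => by
      rw [hτ1 i hi.le, hτ1 (i + 1) hi]
      have e1 := hF i hi.le
      have e2 := hF (i + 1) hi
      rw [pow_succ] at e2 ⊢
      linarith
  have inc2 : r = true → 0 < σ * (-1) ^ (K + 1) * (F (τ (K + 1 + 1)) - F (τ (K + 1))) :=
    fun h => by
      rw [hτ2, hr h, hτ1 K le_rfl, pow_succ]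
      have := hF K le_rfl
      linarith
  have incr : ∀ i, (l = false → 1 ≤ i) → (r = false → i ≤ K) → i ≤ K + 1 →
      0 < σ * (-1) ^ i * (F (τ (i + 1)) - F (τ i)) := fun i hl' hr' hi => by
    rcases Nat.eq_zero_or_pos i with rfl | hpos
    · cases l
      · simp at hl'
      · exact inc0 rfl
    · obtain ⟨i, rfl⟩ := Nat.exists_eq_add_of_lt hpos
      rw [zero_add] at *
      rcases Nat.lt_or_ge i K with h | h
      · exact inc1 i h
      · have : i = K := by omega
        subst this
        cases r
        · simp at hr'
        · exact inc2 rfl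
  cases l
  -- Without a zero at `a` the first increment is dropped; the index shift by one flips the sign
  -- pattern, hence `-σ`.
  · refine altOn_of_increments (σ := -σ) h2 (fun i => τ (i + 1)) (fun i _ => hτS _)
      (fun i hi => hτlt _ ?_) (fun i hi => ?_)
    · cases r <;> simp at hJ <;> omega
    · have := incr (i + 1) (fun _ => by omega) (fun hr => by subst hr; simp at hJ; omega)
        (by cases r <;> simp at hJ <;> omega)
      rw [pow_succ] at this
      linarith
  · refine altOn_of_increments (σ := σ) h2 τ (fun i _ => hτS _)
      (fun i hi => hτlt _ ?_) (fun i hi => ?_)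
    · cases r <;> simp at hJ <;> omega
    · exact incr i (fun h => by simp at h) (fun hr => by subst hr; simp at hJ; omega)
        (by cases r <;> simp at hJ <;> omega)

/-- The number of sign changes of a spline between two knots; each end beyond which the spline
vanishes lowers the bound by the order minus one. -/
theorem IsSpline.signChanges_le (hw : PosWeights w s n) (hf : IsSpline w s n f) {a b : ℤ} {K : ℕ}
    (l r : Bool) (hl : l = true → ∀ x ∈ Ioo ((a : ℝ) - 1) a, f x = 0)
    (hr : r = true → ∀ x ∈ Ioo (b : ℝ) (b + 1), f x = 0) (h : AltOn f (Ioo (a : ℝ) b) K) :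
    (K : ℤ) + 1 + n * (l.toNat + r.toNat) ≤ b - a + n := by
  induction n generalizing s f K with
  | zero =>
    obtain ⟨c, hc⟩ := hf
    obtain ⟨t, σ, hS, ht, hsgn⟩ := h
    -- On one cell a spline of order one has constant sign, so consecutive alternation points lie in
    -- different cells.
    have key : ∀ i ≤ K, a + i ≤ ⌊t i⌋ := by
      intro i
      induction i with
      | zero => intro hi; simpa using Int.le_floor.2 (hS 0 hi).1.le
      | succ i ih =>
        intro hi
        have h1 := ih (by omega)
        have h2 : ⌊t i⌋ ≤ ⌊t (i + 1)⌋ := Int.floor_le_floor (ht i (by omega)).le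
        have h3 : ⌊t i⌋ ≠ ⌊t (i + 1)⌋ := fun heq => by
          have e1 := hsgn i (by omega)
          have e2 := hsgn (i + 1) hi
          rw [hc] at e1 e2
          rw [← heq, pow_succ] at e2
          have e3 : 0 < σ * (-1) ^ i * c ⌊t i⌋ :=
            pos_of_mul_pos_right (a := w s (t i)) (by linarith) (hw.head.2 _).le
          have e4 : 0 < -(σ * (-1) ^ i * c ⌊t i⌋) :=
            pos_of_mul_pos_right (a := w s (t (i + 1))) (by linarith) (hw.head.2 _).le
          linarith
        push_cast
        omega
    have h1 := key K le_rfl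
    have h2 : ⌊t K⌋ < b := Int.floor_lt.2 (hS K le_rfl).2
    push_cast
    omega
  | succ n ih =>
    obtain ⟨F, g, hg, h1, h2⟩ := hf
    have hFc : Continuous F := continuous_of_increment (hg.intervalIntegrable hw.tail) h2
    have hlg := fun h => IsSpline.exists_vanishing hw hg h1 h2 (hl h)
    have hrg := fun h => IsSpline.exists_vanishing hw hg h1 h2 (hr h)
    -- In the first case Rolle yields nothing, and the bound follows from `a < b`, as the interval
    -- contains a point.
    rcases Nat.eq_zero_or_pos (K + l.toNat + r.toNat) with h0 | hpos
    · obtain ⟨t, -, hS, -, -⟩ := h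
      have : (a : ℝ) < b := (hS 0 (by omega)).1.trans (hS 0 (by omega)).2
      have : a < b := by exact_mod_cast this
      have e1 : K = 0 := by omega
      have e2 : l.toNat = 0 := by omega
      have e3 : r.toNat = 0 := by omega
      rw [e1, e2, e3]; push_cast; omega
    · obtain ⟨J, hJ⟩ := Nat.exists_eq_add_of_lt hpos
      have hA := altOn_derivative hw.head.2 h1 h2 l r
        (fun h => eq_zero_of_tendsto_left hFc (by linarith) (hlg h).1)
        (fun h => eq_zero_of_tendsto_right hFc (by linarith) (hrg h).1) h J (by omega)
      have := ih hw.tail hg (fun h => (hlg h).2) (fun h => (hrg h).2) hA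
      have hJ' : (K : ℤ) + l.toNat + r.toNat = J + 1 := by exact_mod_cast (by omega)
      push_cast
      linarith

/-- A spline of support length less than its order vanishes. -/
lemma IsSpline.eq_zero_of_short_support (hw : PosWeights w s n) (hf : IsSpline w s n f) {a b : ℤ}
    (hab : b ≤ a + n) (hl : ∀ x ∈ Ioo ((a : ℝ) - 1) a, f x = 0)
    (hr : ∀ x ∈ Ioo (b : ℝ) (b + 1), f x = 0) : ∀ x ∈ Ioo (a : ℝ) b, f x = 0 := by
  intro x hx
  by_contra hne
  -- One nonzero value is an alternation with `K = 0`; with both ends vanishing the bound reads `1 +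
  -- 2n ≤ b - a + n`.
  have := hf.signChanges_le hw true true (fun _ => hl) (fun _ => hr) (K := 0)
    ⟨fun _ => x, f x, fun _ _ => hx, by simp, fun i hi => by
      obtain rfl : i = 0 := by omega
      simpa using hne⟩
  push_cast at this
  simp at this
  linarith

/-! ### Zeros -/

/-- Between two zeros and around a non-zero, the derivative takes both signs. -/
lemma altOn_of_zeros (h : ∀ x y, F y - F x = ∫ t in x..y, g t) {x y z : ℝ} (hxy : x < y)
    (hyz : y < z) (hx : F x = 0) (hy : F y ≠ 0) (hz : F z = 0) : AltOn g (Ioo x z) 1 := by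
  refine altOn_of_increments (σ := F y) h
    (fun i => if i = 0 then x else if i = 1 then y else z) ?_ ?_ ?_
  · intro i hi
    interval_cases i <;> simp [hxy.le, hyz.le, (hxy.trans hyz).le]
  · intro i hi
    interval_cases i <;> simp <;> assumption
  · intro i hi
    interval_cases i <;> simp [hx, hz, hy]

lemma AltOn.mono {S T : Set ℝ} {K : ℕ} (h : AltOn f S K) (hST : S ⊆ T) : AltOn f T K := by
  obtain ⟨t, σ, h1, h2⟩ := h
  exact ⟨t, σ, fun i hi => hST (h1 i hi), h2⟩

/-- `F` vanishes at the knot `a` by continuity and at `z`. Were it nonzero in between, its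
derivative would change sign within the cell, but a spline that vanishes on the preceding cell has
constant sign there. The next lemma is the mirror image. -/
lemma IsSpline.eq_zero_right (hw : PosWeights w s (n + 1)) (hf : IsSpline w s (n + 1) f) {a : ℤ}
    (hl : ∀ x ∈ Ioo ((a : ℝ) - 1) a, f x = 0) {z : ℝ} (hz : z ∈ Ioo (a : ℝ) (a + 1))
    (hfz : f z = 0) : ∀ x ∈ Ioo (a : ℝ) (a + 1), f x = 0 := by
  refine hf.eq_zero_on_cell hw (u := a) (v := z) hz.1 le_rfl hz.2.le fun y hy => ?_
  obtain ⟨F, g, hg, h1, h2⟩ := hf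
  have hFc : Continuous F := continuous_of_increment (hg.intervalIntegrable hw.tail) h2
  have hlg := IsSpline.exists_vanishing hw hg h1 h2 hl
  rw [h1] at hfz ⊢
  have hFz := (mul_eq_zero.1 hfz).resolve_left (hw.head.2 _).ne'
  by_contra hne
  have hA := altOn_of_zeros h2 hy.1 hy.2
    (eq_zero_of_tendsto_left hFc (by linarith) hlg.1) (right_ne_zero_of_mul hne) hFz
  have := hg.signChanges_le hw.tail (a := a) (b := a + 1) true false (fun _ => hlg.2) (by simp)
    (hA.mono (Ioo_subset_Ioo_right (by push_cast; exact hz.2.le)))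
  simp at this

lemma IsSpline.eq_zero_left (hw : PosWeights w s (n + 1)) (hf : IsSpline w s (n + 1) f) {a : ℤ}
    (hr : ∀ x ∈ Ioo ((a : ℝ) + 1) (a + 1 + 1), f x = 0) {z : ℝ} (hz : z ∈ Ioo (a : ℝ) (a + 1))
    (hfz : f z = 0) : ∀ x ∈ Ioo (a : ℝ) (a + 1), f x = 0 := by
  refine hf.eq_zero_on_cell hw (u := z) (v := a + 1) hz.2 hz.1.le le_rfl fun y hy => ?_
  obtain ⟨F, g, hg, h1, h2⟩ := hf
  have hFc : Continuous F := continuous_of_increment (hg.intervalIntegrable hw.tail) h2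
  have hrg := IsSpline.exists_vanishing hw hg h1 h2 hr
  rw [h1] at hfz ⊢
  have hFz := (mul_eq_zero.1 hfz).resolve_left (hw.head.2 _).ne'
  by_contra hne
  have hA := altOn_of_zeros h2 hy.1 hy.2 hFz (right_ne_zero_of_mul hne)
    (eq_zero_of_tendsto_right hFc (by linarith) hrg.1)
  have := hg.signChanges_le hw.tail (a := a) (b := a + 1) false true (by simp)
    (fun _ => by push_cast; exact hrg.2)
    (hA.mono (by push_cast; exact Ioo_subset_Ioo_left hz.1.le))
  simp at this

/-- A spline with sufficiently many zeros between two knots vanishes on a cell. -/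
lemma IsSpline.exists_zero_cell (hw : PosWeights w s (n + 1)) (hf : IsSpline w s (n + 1) f)
    {N Q : ℕ} (hQ : N + n ≤ Q) (z : ℕ → ℝ) (hz : ∀ i ≤ Q + 1, z i ∈ Ico (0 : ℝ) N)
    (hlt : ∀ i ≤ Q, z i < z (i + 1)) (h0 : ∀ i ≤ Q + 1, f (z i) = 0) :
    ∃ i : ℤ, 0 ≤ i ∧ i < N ∧ ∀ x ∈ Ioo (i : ℝ) (i + 1), f x = 0 := by
  by_contra! hcon
  -- Otherwise `f` would vanish on a piece of the cell containing `z i`, hence on that whole cell.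
  have hne : ∀ i ≤ Q, ∃ y ∈ Ioo (z i) (z (i + 1)), f y ≠ 0 := fun i hi => by
    by_contra! hvan
    have hzi := hz i (by omega)
    obtain ⟨x, hx, hfx⟩ := hcon ⌊z i⌋ (Int.floor_nonneg.2 hzi.1)
      (Int.floor_lt.2 (by exact_mod_cast hzi.2))
    exact hfx (hf.eq_zero_on_cell hw (u := z i) (v := min (z (i + 1)) (⌊z i⌋ + 1))
      (lt_min (hlt i hi) (Int.lt_floor_add_one _)) (Int.floor_le _) (min_le_right _ _)
      (fun y hy => hvan y ⟨hy.1, hy.2.trans_le (min_le_left _ _)⟩) x hx)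
  obtain ⟨F, g, hg, h1, h2⟩ := hf
  have hF0 : ∀ i ≤ Q + 1, F (z i) = 0 := fun i hi => by
    have := h0 i hi
    rw [h1] at this
    exact (mul_eq_zero.1 this).resolve_left (hw.head.2 _).ne'
  -- `F` leaves zero and returns in each gap, so `g` takes both signs there and the sign `(-1) ^ i`
  -- can be prescribed. The `Q + 1` gaps then give `Q` sign changes, too many for `g`.
  have : ∀ i, ∃ y, i ≤ Q → y ∈ Ioo (z i) (z (i + 1)) ∧ 0 < (-1) ^ i * g y := fun i => by
    by_cases hi : i ≤ Q
    · obtain ⟨y, hy, hfy⟩ := hne i hi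
      rw [h1] at hfy
      have hFy := right_ne_zero_of_mul hfy
      rcases lt_or_gt_of_ne (mul_ne_zero (pow_ne_zero i (by norm_num : (-1 : ℝ) ≠ 0)) hFy)
        with hneg | hpos
      · obtain ⟨t, ht, ht'⟩ := exists_pos_of_increment h2 ((-1) ^ i) hy.2
          (by rw [hF0 (i + 1) (by omega)]; linarith)
        exact ⟨t, fun _ => ⟨⟨hy.1.trans ht.1, ht.2⟩, ht'⟩⟩
      · obtain ⟨t, ht, ht'⟩ := exists_pos_of_increment h2 ((-1) ^ i) hy.1
          (by rw [hF0 i (by omega)]; linarith)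
        exact ⟨t, fun _ => ⟨⟨ht.1, ht.2.trans hy.2⟩, ht'⟩⟩
    · exact ⟨0, fun h => absurd h hi⟩
  choose y hy using this
  have := hg.signChanges_le hw.tail (a := 0) (b := N) (K := Q) false false (by simp) (by simp)
    ⟨y, 1, fun i hi => ⟨?_, ?_⟩, fun i hi => ?_, fun i hi => ?_⟩
  · simp at this
    omega
  · simpa using (hz i (by omega)).1.trans_lt (hy i hi).1.1
  · simpa using (hy i hi).1.2.trans (hz (i + 1) (by omega)).2
  · exact (hy i hi.le).1.2.trans (hy (i + 1) hi).1.1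
  · simpa using (hy i hi).2

/-- A spline with sufficiently many zeros, and zeros in all cells, vanishes on all cells. -/
lemma IsSpline.eq_zero_of_zeros (hw : PosWeights w s (n + 1)) (hf : IsSpline w s (n + 1) f)
    {N Q : ℕ} (hQ : N + n ≤ Q) (z : ℕ → ℝ) (hz : ∀ i ≤ Q + 1, z i ∈ Ico (0 : ℝ) N)
    (hlt : ∀ i ≤ Q, z i < z (i + 1)) (h0 : ∀ i ≤ Q + 1, f (z i) = 0)
    (hcell : ∀ i < N, ∃ y ∈ Ioo (i : ℝ) (i + 1), f y = 0) :
    ∀ i : ℕ, i < N → ∀ x ∈ Ioo (i : ℝ) (i + 1), f x = 0 := by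
  obtain ⟨j, hj0, hjN, hj⟩ := hf.exists_zero_cell hw hQ z hz hlt h0
  lift j to ℕ using hj0
  have hjN' : j < N := by exact_mod_cast hjN
  have right : ∀ d : ℕ, j + d < N → ∀ x ∈ Ioo ((j + d : ℕ) : ℝ) ((j + d : ℕ) + 1), f x = 0 := by
    intro d
    induction d with
    | zero => intro _; simpa using hj
    | succ d ih =>
      intro hd
      obtain ⟨y, hy, hfy⟩ := hcell (j + (d + 1)) hd
      have := hf.eq_zero_right hw (a := ((j + (d + 1) : ℕ) : ℤ)) (z := y)
        (by
          have := ih (by omega)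
          push_cast at this ⊢
          rwa [show (j : ℝ) + (d + 1) - 1 = j + d by ring, ← add_assoc])
        (by simpa using hy) hfy
      simpa using this
  have left : ∀ d : ℕ, d ≤ j → ∀ x ∈ Ioo ((j - d : ℕ) : ℝ) ((j - d : ℕ) + 1), f x = 0 := by
    intro d
    induction d with
    | zero => intro _; simpa using hj
    | succ d ih =>
      intro hd
      obtain ⟨y, hy, hfy⟩ := hcell (j - (d + 1)) (by omega)
      have := hf.eq_zero_left hw (a := ((j - (d + 1) : ℕ) : ℤ)) (z := y)
        (by
          have := ih (by omega)
          rw [show j - d = j - (d + 1) + 1 by omega] at this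
          push_cast at this ⊢
          exact this)
        (by simpa using hy) hfy
      simpa using this
  intro i hi
  rcases le_total j i with h | h
  · have := right (i - j) (by omega)
    rwa [show j + (i - j) = i by omega] at this
  · have := left (j - i) (by omega)
    rwa [show j - (j - i) = i by omega] at this

end Spline

section Pieces

/-! ### Periodic exponential B-splines are splines -/

/-- The real span of the iterated integrals for the weights `w s, …, w (s + n)`. -/
def IsPiece (w : ℕ → ℝ → ℝ) (a : ℝ) : ℕ → ℕ → (ℝ → ℝ) → Prop
  | s, 0, u => ∃ c : ℝ, ∀ x, u x = w s x * c
  | s, n + 1, u => ∃ (c : ℝ) (v : ℝ → ℝ), IsPiece w a (s + 1) n v ∧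
      ∀ x, u x = w s x * (c + ∫ t in a..x, v t)

variable {w : ℕ → ℝ → ℝ} {a : ℝ} {s n : ℕ} {u v : ℝ → ℝ}

lemma IsPiece.continuous (hw : PosWeights w s n) (hu : IsPiece w a s n u) : Continuous u := by
  induction n generalizing s u with
  | zero =>
    obtain ⟨c, hc⟩ := hu
    rw [funext hc]
    exact hw.head.1.mul continuous_const
  | succ n ih =>
    obtain ⟨c, v, hv, h⟩ := hu
    rw [funext h]
    exact hw.head.1.mul (continuous_const.add (intervalIntegral.continuous_primitive
      (fun _ _ => (ih hw.tail hv).intervalIntegrable _ _) a))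

lemma isPiece_zero : IsPiece w a s n (fun _ => 0) := by
  induction n generalizing s with
  | zero => exact ⟨0, by simp⟩
  | succ n ih => exact ⟨0, _, ih, by simp⟩

lemma IsPiece.const_mul (c : ℝ) (hu : IsPiece w a s n u) :
    IsPiece w a s n (fun x => c * u x) := by
  induction n generalizing s u with
  | zero =>
    obtain ⟨d, hd⟩ := hu
    exact ⟨c * d, fun x => by simp only [hd]; ring⟩
  | succ n ih =>
    obtain ⟨d, v, hv, h⟩ := hu
    refine ⟨c * d, _, ih hv, fun x => ?_⟩
    simp only [intervalIntegral.integral_const_mul, h]; ring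

lemma IsPiece.add (hw : PosWeights w s n) (hu : IsPiece w a s n u) (hv : IsPiece w a s n v) :
    IsPiece w a s n (fun x => u x + v x) := by
  induction n generalizing s u v with
  | zero =>
    obtain ⟨c, hc⟩ := hu
    obtain ⟨d, hd⟩ := hv
    exact ⟨c + d, fun x => by simp only [hc, hd]; ring⟩
  | succ n ih =>
    obtain ⟨c, u', hu', h1⟩ := hu
    obtain ⟨d, v', hv', h2⟩ := hv
    refine ⟨c + d, _, ih hw.tail hu' hv', fun x => ?_⟩
    rw [intervalIntegral.integral_add ((hu'.continuous hw.tail).intervalIntegrable _ _)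
      ((hv'.continuous hw.tail).intervalIntegrable _ _)]
    simp only [h1, h2]
    ring

lemma isPiece_iterInt {j : ℕ} (hj : j ≤ n) : IsPiece w a s n (iterInt w a s j) := by
  induction n generalizing s j with
  | zero =>
    obtain rfl : j = 0 := by omega
    exact ⟨1, fun x => by simp [iterInt]⟩
  | succ n ih =>
    cases j with
    | zero => exact ⟨1, _, isPiece_zero, fun x => by simp [iterInt]⟩
    | succ j => exact ⟨0, _, ih (j := j) (by omega), fun x => by simp [iterInt]⟩

lemma isPiece_of_mem_eccSpace (hw : PosWeights w 1 n) {g : ℝ → ℂ}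
    (hg : g ∈ eccSpace w a (n + 1)) :
    IsPiece w a 1 n (fun x => (g x).re) ∧ IsPiece w a 1 n (fun x => (g x).im) := by
  induction hg using Submodule.span_induction with
  | mem g hg =>
    obtain ⟨l, hl, rfl⟩ := hg
    rw [Finset.mem_Icc] at hl
    exact ⟨by simpa [eccFun] using isPiece_iterInt (by omega), by simpa using isPiece_zero⟩
  | zero => exact ⟨by simpa using isPiece_zero, by simpa using isPiece_zero⟩
  | add g h _ _ hg hh => exact ⟨by simpa using hg.1.add hw hh.1, by simpa using hg.2.add hw hh.2⟩
  | smul c g _ hg =>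
    constructor
    · convert (hg.1.const_mul c.re).add hw (hg.2.const_mul (-c.im)) using 2
      simp; ring
    · convert (hg.2.const_mul c.re).add hw (hg.1.const_mul c.im) using 2
      simp

/-- A right continuous, sufficiently smooth, piecewise Chebyshevian function is a spline. -/
lemma isSpline_of_pieces (hw : PosWeights w s n)
    (hwc : ∀ j, s ≤ j → j ≤ s + n → ContDiff ℝ ((s + n - j : ℕ) : WithTop ℕ∞) (w j))
    {f : ℝ → ℝ} (hf : 1 ≤ n → ContDiff ℝ ((n - 1 : ℕ) : WithTop ℕ∞) f)
    (hr : ∀ x, ContinuousWithinAt f (Ici x) x)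
    (hp : ∀ i : ℤ, ∃ u, IsPiece w a s n u ∧ EqOn f u (Ioo (i : ℝ) (i + 1))) :
    IsSpline w s n f := by
  -- Right continuity extends the agreement to the left knot of each cell.
  have hp' : ∀ i : ℤ, ∃ u, IsPiece w a s n u ∧ EqOn f u (Ico (i : ℝ) (i + 1)) := fun i => by
    obtain ⟨u, hu, hfu⟩ := hp i
    refine ⟨u, hu, fun x hx => ?_⟩
    rcases eq_or_lt_of_le hx.1 with rfl | h
    · have h1 : Filter.Tendsto f (nhdsWithin (i : ℝ) (Ioi i)) (nhds (f i)) :=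
        (hr i).mono Ioi_subset_Ici_self
      have h2 : Filter.Tendsto f (nhdsWithin (i : ℝ) (Ioi i)) (nhds (u i)) := by
        refine ((hu.continuous hw).continuousWithinAt (s := Ioi (i : ℝ)) (x := i)
          ).tendsto.congr' ?_
        filter_upwards [Ioo_mem_nhdsGT (show (i : ℝ) < i + 1 by linarith)] with y hy
        exact (hfu hy).symm
      exact tendsto_nhds_unique h1 h2
    · exact hfu ⟨h, hx.2⟩
  have hcell : ∀ x : ℝ, x ∈ Ico (⌊x⌋ : ℝ) (⌊x⌋ + 1) := fun x =>
    ⟨Int.floor_le x, Int.lt_floor_add_one x⟩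
  clear hp
  induction n generalizing s f with
  | zero =>
    choose u hu hfu using hp'
    choose c hc using hu
    exact ⟨c, fun x => by rw [hfu ⌊x⌋ (hcell x), hc]⟩
  | succ n ih =>
    choose u hu hfu using hp'
    choose c v hv hcv using hu
    set F : ℝ → ℝ := fun x => f x / w s x with hF
    set g : ℝ → ℝ := fun x => v ⌊x⌋ x with hg
    have hws : ∀ x, w s x ≠ 0 := fun x => (hw.head.2 x).ne'
    have hFsm : ContDiff ℝ (n : WithTop ℕ∞) F := by
      have h1 : ContDiff ℝ (n : WithTop ℕ∞) f := by simpa using hf (by omega)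
      refine h1.div ((hwc s le_rfl (by omega)).of_le ?_) hws
      exact_mod_cast (by omega : n ≤ s + (n + 1) - s)
    have hFi : ∀ (i : ℤ), ∀ x ∈ Ico (i : ℝ) (i + 1), F x = c i + ∫ t in a..x, v i t :=
      fun i x hx => by
        simp only [hF]
        rw [hfu i hx, hcv, mul_div_cancel_left₀ _ (hws x)]
    have hgi : ∀ (i : ℤ), ∀ x ∈ Ico (i : ℝ) (i + 1), g x = v i x := fun i x hx => by
      simp only [hg]
      rw [Int.floor_eq_iff.2 ⟨hx.1, hx.2⟩]
    have hvc : ∀ i, Continuous (v i) := fun i => (hv i).continuous hw.tail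
    -- A right derivative exists even at the knots. It suffices for the fundamental theorem of
    -- calculus below, also when `F` is merely continuous, and it equals `deriv F` once `F` is
    -- differentiable.
    have hder : ∀ x, HasDerivWithinAt F (g x) (Ici x) x := fun x => by
      have h1 : HasDerivAt (fun y => c ⌊x⌋ + ∫ t in a..y, v ⌊x⌋ t) (g x) x :=
        ((hvc ⌊x⌋).integral_hasStrictDerivAt a x).hasDerivAt.const_add _
      refine h1.hasDerivWithinAt.congr_of_eventuallyEq ?_ (hFi _ x (hcell x))
      have : ∀ᶠ y : ℝ in nhdsWithin x (Ici x), y < ⌊x⌋ + 1 :=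
        mem_nhdsWithin_of_mem_nhds (Iio_mem_nhds (hcell x).2)
      filter_upwards [this, self_mem_nhdsWithin] with y h1 h2
      exact hFi _ y ⟨(hcell x).1.trans h2, h1⟩
    have hgr : ∀ x, ContinuousWithinAt g (Ici x) x := fun x => by
      refine (hvc ⌊x⌋).continuousWithinAt.congr_of_eventuallyEq ?_ rfl
      have : ∀ᶠ y : ℝ in nhdsWithin x (Ici x), y < ⌊x⌋ + 1 :=
        mem_nhdsWithin_of_mem_nhds (Iio_mem_nhds (hcell x).2)
      filter_upwards [this, self_mem_nhdsWithin] with y h1 h2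
      exact hgi _ y ⟨(hcell x).1.trans h2, h1⟩
    have hgs : IsSpline w (s + 1) n g := by
      refine ih hw.tail (fun j h1 h2 => ?_) (fun hn => ?_) hgr (fun i => ⟨v i, hv i, hgi i⟩)
      · have := hwc j (by omega) (by omega)
        rwa [show s + 1 + n - j = s + (n + 1) - j by omega]
      · obtain ⟨n, rfl⟩ := Nat.exists_eq_add_of_le' hn
        have h1 : ContDiff ℝ ((n : WithTop ℕ∞) + 1) F := by exact_mod_cast hFsm
        have h2 := (contDiff_succ_iff_deriv.1 h1)
        have : g = deriv F := funext fun x => by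
          exact (uniqueDiffWithinAt_Ici x).eq_deriv _ (hder x)
            (h2.1 x).hasDerivAt.hasDerivWithinAt
        rw [this]
        simpa using h2.2.2
    refine ⟨F, g, hgs, fun x => by simp only [hF]; field_simp [hws x], ?_⟩
    have key : ∀ x y, x ≤ y → F y - F x = ∫ t in x..y, g t := fun x y hxy =>
      (intervalIntegral.integral_eq_sub_of_hasDeriv_right_of_le hxy hFsm.continuous.continuousOn
        (fun z _ => (hder z).mono Ioi_subset_Ici_self)
        (hgs.intervalIntegrable hw.tail x y)).symm
    intro x y
    rcases le_total x y with h | h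
    · exact key x y h
    · rw [intervalIntegral.integral_symm, ← key y x h]; ring

/-! ### Complex splines -/

/-- Complex-valued splines. -/
def IsCSpline (w : ℕ → ℝ → ℝ) (n : ℕ) (f : ℝ → ℂ) : Prop :=
  IsSpline w 1 n (fun x => (f x).re) ∧ IsSpline w 1 n (fun x => (f x).im)

lemma IsCSpline.const_mul (hw : PosWeights w 1 n) {f : ℝ → ℂ} (hf : IsCSpline w n f) (c : ℂ) :
    IsCSpline w n (fun x => c * f x) := by
  constructor
  · convert (hf.1.const_mul c.re).add hw (hf.2.const_mul (-c.im)) using 2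
    simp; ring
  · convert (hf.2.const_mul c.re).add hw (hf.1.const_mul c.im) using 2
    simp

lemma IsCSpline.sum (hw : PosWeights w 1 n) {ι : Type*} (S : Finset ι) (f : ι → ℝ → ℂ)
    (hf : ∀ i ∈ S, IsCSpline w n (f i)) : IsCSpline w n (fun x => ∑ i ∈ S, f i x) := by
  classical
  induction S using Finset.induction_on with
  | empty => exact ⟨by simpa using isSpline_zero, by simpa using isSpline_zero⟩
  | insert i S hi ih =>
    have h1 := hf i (Finset.mem_insert_self _ _)
    have h2 := ih fun j hj => hf j (Finset.mem_insert_of_mem hj)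
    simp only [Finset.sum_insert hi]
    exact ⟨by simpa using h1.1.add hw h2.1, by simpa using h1.2.add hw h2.2⟩

/-- A normalised generator: a spline of order `n + 1` with support `[0, n + 1]`, all of whose
integer shifts are splines for the same weights. -/
structure IsGenerator (w : ℕ → ℝ → ℝ) (n : ℕ) (ψ : ℝ → ℂ) : Prop where
  posWeights : PosWeights w 1 n
  isCSpline : ∀ l : ℤ, IsCSpline w n (fun x => ψ (x - l))
  zero_left : ∀ x < 0, ψ x = 0
  zero_right : ∀ x, (n : ℝ) + 1 ≤ x → ψ x = 0
  ne_zero : ∃ x ∈ Ico (0 : ℝ) 1, ψ x ≠ 0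

/-- The exponential contributes the factor `exp (-γ l)` and the periodic factor is unchanged.
Because of this, all integer shifts of the B-spline are splines for one and the same system of
weights. -/
lemma IsPEBWeights.shift {m : ℕ} (hw : IsPEBWeights m w) {j : ℕ} (hj : j ∈ Finset.Icc 1 m)
    (l : ℤ) : ∃ κ : ℝ, ∀ x, w j (x - l) = κ * w j x := by
  obtain ⟨γ, r, -, hr, -, h⟩ := hw j hj
  refine ⟨Real.exp (-(γ * l)), fun x => ?_⟩
  have : r (x - l) = r x := by simpa using hr.sub_int_mul_eq (x := x) l
  rw [h, h, this, ← mul_assoc, ← Real.exp_add]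
  ring_nf

lemma IsPEBWeights.contDiff {m : ℕ} (hw : IsPEBWeights m w) {j : ℕ} (hj : j ∈ Finset.Icc 1 m) :
    ContDiff ℝ ((m - j : ℕ) : WithTop ℕ∞) (w j) := by
  obtain ⟨γ, r, hr, -, -, h⟩ := hw j hj
  rw [funext h]
  exact (Real.contDiff_exp.comp (contDiff_const.mul contDiff_id)).mul hr

lemma IsPEBWeights.pos {m : ℕ} (hw : IsPEBWeights m w) {j : ℕ} (hj : j ∈ Finset.Icc 1 m)
    (x : ℝ) : 0 < w j x := by
  obtain ⟨γ, r, -, -, hr, h⟩ := hw j hj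
  rw [h]
  exact mul_pos (Real.exp_pos _) (hr x)

/-- The translation by `k` moves the support to `[0, n + 1]`. The weights stay those of `φ`, since
only the integer shifts matter. -/
theorem IsPEBSpline.exists_isGenerator {φ : ℝ → ℂ} (hφ : IsPEBSpline (n + 1) φ) :
    ∃ (w : ℕ → ℝ → ℝ) (k : ℤ), IsGenerator w n (fun x => φ (x + k)) := by
  obtain ⟨w, k, hw, hsm, hr, hp, hsupp⟩ := hφ
  have hpos : PosWeights w 1 n := fun j h1 h2 =>
    ⟨(hw.contDiff (Finset.mem_Icc.2 ⟨h1, by omega⟩)).continuous,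
      hw.pos (Finset.mem_Icc.2 ⟨h1, by omega⟩)⟩
  have hout : ∀ x ∉ Icc (k : ℝ) (k + (n + 1)), φ x = 0 := fun x hx => by
    refine image_eq_zero_of_notMem_tsupport ?_
    rw [hsupp]; simpa using hx
  have hpiece : ∀ i : ℤ, ∃ u : ℝ → ℂ, (IsPiece w k 1 n (fun x => (u x).re) ∧
      IsPiece w k 1 n (fun x => (u x).im)) ∧ EqOn φ u (Ioo (i : ℝ) (i + 1)) := fun i => by
    by_cases hi : k ≤ i ∧ i < k + (n + 1)
    · obtain ⟨d, rfl⟩ := Int.le.dest hi.1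
      obtain ⟨u, hu, hfu⟩ := hp d (by omega)
      exact ⟨u, isPiece_of_mem_eccSpace hpos hu, by simpa using hfu⟩
    · refine ⟨0, ⟨by simpa using isPiece_zero, by simpa using isPiece_zero⟩, fun x hx => ?_⟩
      refine hout x fun hx' => hi ⟨?_, ?_⟩
      · have : (k : ℝ) < i + 1 := hx'.1.trans_lt hx.2
        have : k < i + 1 := by exact_mod_cast this
        omega
      · have : (i : ℝ) < k + (n + 1) := hx.1.trans_le hx'.2
        exact_mod_cast this
  have hwc : ∀ j, 1 ≤ j → j ≤ 1 + n → ContDiff ℝ ((1 + n - j : ℕ) : WithTop ℕ∞) (w j) :=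
    fun j h1 h2 => by
      rw [add_comm 1 n]
      exact hw.contDiff (Finset.mem_Icc.2 ⟨h1, by omega⟩)
  have hspl : IsCSpline w n φ := by
    constructor
    · refine isSpline_of_pieces (a := k) hpos hwc (fun hn => ?_) (fun x => ?_) fun i => ?_
      · exact Complex.reCLM.contDiff.comp (hsm (by omega))
      · exact Complex.continuous_re.continuousAt.comp_continuousWithinAt (hr x)
      · obtain ⟨u, hu, h⟩ := hpiece i
        exact ⟨_, hu.1, fun x hx => by simp only [h hx]⟩
    · refine isSpline_of_pieces (a := k) hpos hwc (fun hn => ?_) (fun x => ?_) fun i => ?_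
      · exact Complex.imCLM.contDiff.comp (hsm (by omega))
      · exact Complex.continuous_im.continuousAt.comp_continuousWithinAt (hr x)
      · obtain ⟨u, hu, h⟩ := hpiece i
        exact ⟨_, hu.2, fun x hx => by simp only [h hx]⟩
  refine ⟨w, k, hpos, fun l => ?_, fun x hx => ?_, fun x hx => ?_, ?_⟩
  · have hl : ∀ j, 1 ≤ j → j ≤ 1 + n → ∃ κ : ℝ, ∀ x, w j (x - (l - k : ℤ)) = κ * w j x :=
      fun j h1 h2 => hw.shift (Finset.mem_Icc.2 ⟨h1, by omega⟩) _
    have h1 := hspl.1.comp_sub_int (l - k) hl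
    have h2 := hspl.2.comp_sub_int (l - k) hl
    push_cast at h1 h2
    simp only [sub_sub_eq_add_sub, add_sub_right_comm] at h1 h2
    exact ⟨h1, h2⟩
  · exact hout _ fun h => by linarith [h.1]
  -- At the right end of the support the value is zero by right continuity, which matters for order
  -- one.
  · rcases eq_or_lt_of_le hx with rfl | h
    · have h1 : Filter.Tendsto φ (nhdsWithin ((n : ℝ) + 1 + k) (Ioi (n + 1 + k)))
          (nhds (φ (n + 1 + k))) := (hr _).mono Ioi_subset_Ici_self
      have h2 : Filter.Tendsto φ (nhdsWithin ((n : ℝ) + 1 + k) (Ioi (n + 1 + k))) (nhds 0) := by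
        refine tendsto_const_nhds.congr' ?_
        filter_upwards [self_mem_nhdsWithin] with y hy
        exact (hout y fun h => by linarith [h.2, mem_Ioi.1 hy]).symm
      exact tendsto_nhds_unique h1 h2
    · exact hout _ fun h' => by linarith [h'.2]
  -- As `k` lies in the closed support, there are nonzero values arbitrarily near it, and none to
  -- its left.
  · have hk : (k : ℝ) ∈ tsupport φ := by
      rw [hsupp]; exact ⟨le_rfl, by have : (0 : ℝ) ≤ (n + 1 : ℕ) := by positivity
                                    linarith⟩
    obtain ⟨y, hy, hy'⟩ := mem_closure_iff.1 hk (Ioo (k - 1 : ℝ) (k + 1)) isOpen_Ioo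
      ⟨by linarith, by linarith⟩
    refine ⟨y - k, ⟨?_, by linarith [hy.2]⟩, by simpa using hy'⟩
    by_contra hneg
    exact hy' (hout y fun h => by linarith [h.1])

end Pieces

section Local

/-! ### The local sampling inequality -/

variable {w : ℕ → ℝ → ℝ} {n : ℕ} {ψ : ℝ → ℂ}

lemma IsGenerator.isCSpline_sum (h : IsGenerator w n ψ) (S : Finset ℤ) (c : ℤ → ℂ) :
    IsCSpline w n (fun x => ∑ l ∈ S, c l * ψ (x - l)) :=
  IsCSpline.sum h.posWeights S (fun l x => c l * ψ (x - l)) fun l _ =>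
    (h.isCSpline l).const_mul h.posWeights (c l)

lemma IsGenerator.continuousWithinAt (h : IsGenerator w n ψ) (x : ℝ) :
    ContinuousWithinAt ψ (Ici x) x := by
  have h0 := h.isCSpline 0
  simp only [Int.cast_zero, sub_zero] at h0
  have h1 := Complex.continuous_ofReal.continuousAt.comp_continuousWithinAt
    (h0.1.continuousWithinAt h.posWeights x)
  have h2 := Complex.continuous_ofReal.continuousAt.comp_continuousWithinAt
    (h0.2.continuousWithinAt h.posWeights x)
  refine (h1.add (h2.mul (continuousWithinAt_const (b := Complex.I)))).congr
    (fun y _ => ?_) ?_ <;> simp [Complex.re_add_im]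

lemma IsGenerator.continuous (h : IsGenerator w (n + 1) ψ) : Continuous ψ := by
  have h0 := h.isCSpline 0
  simp only [Int.cast_zero, sub_zero] at h0
  have h1 := Complex.continuous_ofReal.comp (h0.1.continuous h.posWeights)
  have h2 := Complex.continuous_ofReal.comp (h0.2.continuous h.posWeights)
  refine (h1.add (h2.mul (continuous_const (y := Complex.I)))).congr fun y => ?_
  simp [Complex.re_add_im]

lemma IsGenerator.exists_ne_zero (h : IsGenerator w n ψ) : ∃ x ∈ Ioo (0 : ℝ) 1, ψ x ≠ 0 := by
  obtain ⟨x, hx, hne⟩ := h.ne_zero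
  have h1 : ∀ᶠ y in nhdsWithin x (Ioi x), ψ y ≠ 0 :=
    ((h.continuousWithinAt x).mono Ioi_subset_Ici_self).eventually_ne hne
  obtain ⟨y, hy, hy'⟩ := (h1.and (Ioo_mem_nhdsGT hx.2)).exists
  exact ⟨y, ⟨hx.1.trans_lt hy'.1, hy'.2⟩, hy⟩

/-- Local linear independence of the shifts of the generator. -/
lemma IsGenerator.coeff_eq_zero (h : IsGenerator w n ψ) (c : ℤ → ℂ) (i : ℤ)
    (h0 : ∀ x ∈ Ioo (i : ℝ) (i + 1), ∑ l ∈ Finset.Icc (i - n) i, c l * ψ (x - l) = 0) :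
    ∀ l ∈ Finset.Icc (i - n) i, c l = 0 := by
  set H : ℝ → ℂ := fun x => ∑ l ∈ Finset.Icc (i - n) i, c l * ψ (x - l) with hH
  have hHs : IsCSpline w n H := h.isCSpline_sum _ c
  have hleft : ∀ x < ((i - n : ℤ) : ℝ), H x = 0 := fun x hx => by
    refine Finset.sum_eq_zero fun l hl => ?_
    have : ((i - n : ℤ) : ℝ) ≤ l := by exact_mod_cast (Finset.mem_Icc.1 hl).1
    rw [h.zero_left _ (by linarith), mul_zero]
  -- `H` vanishes before `i - n` and on the cell after `i`; the `n` cells in between are too few for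
  -- order `n + 1`.
  have hmid : ∀ x ∈ Ioo ((i - n : ℤ) : ℝ) i, H x = 0 := fun x hx => by
    have h1 := hHs.1.eq_zero_of_short_support h.posWeights (a := i - n) (b := i) (by omega)
      (fun x hx => by rw [hleft x hx.2]; rfl) (fun x hx => by
        have : H x = 0 := h0 x hx
        rw [this]; rfl) x hx
    have h2 := hHs.2.eq_zero_of_short_support h.posWeights (a := i - n) (b := i) (by omega)
      (fun x hx => by rw [hleft x hx.2]; rfl) (fun x hx => by
        have : H x = 0 := h0 x hx
        rw [this]; rfl) x hx
    exact Complex.ext h1 h2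
  obtain ⟨x₀, hx₀, hne⟩ := h.exists_ne_zero
  -- From left to right: on the cell starting at `i - n + d` the earlier coefficients are already
  -- zero and the later shifts have not yet begun.
  have key : ∀ d : ℕ, d ≤ n → c (i - n + d) = 0 := by
    intro d
    induction d using Nat.strong_induction_on with
    | _ d ih =>
      intro hd
      have hx : H (x₀ + (i - n + d : ℤ)) = 0 := by
        rcases eq_or_lt_of_le hd with rfl | hlt
        · refine h0 _ ?_
          push_cast
          constructor <;> linarith [hx₀.1, hx₀.2]
        · refine hmid _ ?_
          have : (d : ℝ) + 1 ≤ n := by exact_mod_cast hlt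
          push_cast
          constructor <;> linarith [hx₀.1, hx₀.2, (Nat.cast_nonneg d : (0 : ℝ) ≤ d)]
      rw [hH] at hx
      simp only at hx
      rw [Finset.sum_eq_single (i - n + d)] at hx
      · rw [add_sub_cancel_right] at hx
        exact (mul_eq_zero.1 hx).resolve_right hne
      · intro l hl hld
        rw [Finset.mem_Icc] at hl
        rcases lt_or_gt_of_ne hld with hlt | hgt
        · obtain ⟨e, he⟩ := Int.le.dest hl.1
          rw [← he, ih e (by omega) (by omega), zero_mul]
        · have : ((i - n + d : ℤ) : ℝ) + 1 ≤ l := by exact_mod_cast hgt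
          rw [h.zero_left _ (by linarith [hx₀.2]), mul_zero]
      · intro hnot
        exact absurd (Finset.mem_Icc.2 ⟨by omega, by omega⟩) hnot
  intro l hl
  rw [Finset.mem_Icc] at hl
  obtain ⟨e, he⟩ := Int.le.dest hl.1
  rw [← he]
  exact key e (by omega)

lemma IsGenerator.sum_Ico_eq (h : IsGenerator w n ψ) (c : ℤ → ℂ) (N : ℕ) {i : ℤ} (hi : 0 ≤ i)
    (hiN : i < N) {x : ℝ} (hx : x ∈ Ico (i : ℝ) (i + 1)) :
    ∑ l ∈ Finset.Ico (-(n : ℤ)) N, c l * ψ (x - l) =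
      ∑ l ∈ Finset.Icc (i - n) i, c l * ψ (x - l) := by
  symm
  refine Finset.sum_subset (fun l hl => ?_) fun l hl hl' => ?_
  · rw [Finset.mem_Icc] at hl
    exact Finset.mem_Ico.2 ⟨by omega, by omega⟩
  · rw [Finset.mem_Icc, not_and_or, not_le, not_le] at hl'
    rcases hl' with hlt | hgt
    · have : (l : ℝ) + 1 ≤ i - n := by exact_mod_cast hlt
      rw [h.zero_right _ (by linarith [hx.1]), mul_zero]
    · have : (i : ℝ) + 1 ≤ l := by exact_mod_cast hgt
      rw [h.zero_left _ (by linarith [hx.2]), mul_zero]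

/-- There are `N + n + 1` shifts active on the `N` cells, and at least one more zero. Real and
imaginary parts vanish on all cells, and local independence on each cell removes the coefficients.
-/
lemma IsGenerator.coeff_eq_zero_of_zeros (h : IsGenerator w (n + 1) ψ) {N Q : ℕ} (hN : 0 < N)
    (hQ : N + n ≤ Q) (c : ℤ → ℂ) (z : ℕ → ℝ) (hz : ∀ i ≤ Q + 1, z i ∈ Ico (0 : ℝ) N)
    (hlt : ∀ i ≤ Q, z i < z (i + 1))
    (h0 : ∀ i ≤ Q + 1, ∑ l ∈ Finset.Ico (-((n + 1 : ℕ) : ℤ)) N, c l * ψ (z i - l) = 0)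
    (hcell : ∀ i < N, ∃ y ∈ Ioo (i : ℝ) (i + 1),
      ∑ l ∈ Finset.Ico (-((n + 1 : ℕ) : ℤ)) N, c l * ψ (y - l) = 0) :
    ∀ l ∈ Finset.Ico (-((n + 1 : ℕ) : ℤ)) N, c l = 0 := by
  have hs := h.isCSpline_sum (Finset.Ico (-((n + 1 : ℕ) : ℤ)) N) c
  have h1 := hs.1.eq_zero_of_zeros h.posWeights hQ z hz hlt (fun i hi => congrArg Complex.re (h0 i hi))
    (fun i hi => (hcell i hi).imp fun y hy => ⟨hy.1, congrArg Complex.re hy.2⟩)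
  have h2 := hs.2.eq_zero_of_zeros h.posWeights hQ z hz hlt (fun i hi => congrArg Complex.im (h0 i hi))
    (fun i hi => (hcell i hi).imp fun y hy => ⟨hy.1, congrArg Complex.im hy.2⟩)
  have key : ∀ i : ℕ, i < N → ∀ l ∈ Finset.Icc ((i : ℤ) - (n + 1 : ℕ)) i, c l = 0 := fun i hi =>
    h.coeff_eq_zero c i fun x hx => by
      rw [← h.sum_Ico_eq c N (i := i) (by omega) (by omega) ⟨hx.1.le, hx.2⟩]
      exact Complex.ext (h1 i hi x (by simpa using hx)) (h2 i hi x (by simpa using hx))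
  intro l hl
  rw [Finset.mem_Ico] at hl
  rcases lt_or_ge l 0 with hneg | hpos
  · exact key 0 hN l (Finset.mem_Icc.2 ⟨by push_cast at *; omega, by push_cast; omega⟩)
  · lift l to ℕ using hpos
    exact key l (by omega) l (Finset.mem_Icc.2 ⟨by omega, le_rfl⟩)

/-! ### Compactness and the choice of the window. -/

/-- Compactness turns uniqueness into a uniform lower bound. -/
lemma exists_lower_bound {ι κ : Type*} [Fintype ι] [Nonempty ι] [Fintype κ]
    (J : κ → Set ℝ) (hJ : ∀ j, IsCompact (J j)) (b : ι → ℝ → ℂ) (hb : ∀ l, Continuous (b l))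
    (huniq : ∀ (c : ι → ℂ) (z : κ → ℝ), (∀ j, z j ∈ J j) → (∀ j, ∑ l, c l * b l (z j) = 0) →
      c = 0) :
    ∃ δ > 0, ∀ (c : ι → ℂ) (z : κ → ℝ), (∀ j, z j ∈ J j) →
      δ * ‖c‖ ≤ ∑ j, ‖∑ l, c l * b l (z j)‖ := by
  by_cases hne : ∃ z₀ : κ → ℝ, ∀ j, z₀ j ∈ J j
  swap
  · exact ⟨1, one_pos, fun c z hz => absurd ⟨z, hz⟩ hne⟩
  obtain ⟨z₀, hz₀⟩ := hne
  set S : Set ((ι → ℂ) × (κ → ℝ)) := Metric.sphere 0 1 ×ˢ Set.pi univ J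
  have hS : IsCompact S := (isCompact_sphere _ _).prod (isCompact_univ_pi hJ)
  have hSne : S.Nonempty := by
    obtain ⟨c₀, hc₀⟩ := (NormedSpace.sphere_nonempty (E := ι → ℂ) (x := 0) (r := 1)).2 zero_le_one
    exact ⟨(c₀, z₀), hc₀, fun j _ => hz₀ j⟩
  have hcont : Continuous fun q : (ι → ℂ) × (κ → ℝ) => ∑ j, ‖∑ l, q.1 l * b l (q.2 j)‖ := by
    refine continuous_finsetSum _ fun j _ => (continuous_finsetSum _ fun l _ => ?_).norm
    exact ((continuous_apply l).comp continuous_fst).mul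
      ((hb l).comp ((continuous_apply j).comp continuous_snd))
  obtain ⟨⟨c₁, z₁⟩, ⟨hc₁, hz₁⟩, hmin⟩ := hS.exists_isMinOn hSne hcont.continuousOn
  refine ⟨∑ j, ‖∑ l, c₁ l * b l (z₁ j)‖, ?_, fun c z hz => ?_⟩
  · refine lt_of_le_of_ne (Finset.sum_nonneg fun _ _ => norm_nonneg _) fun heq => ?_
    have h0 := (Finset.sum_eq_zero_iff_of_nonneg fun j _ => norm_nonneg _).1 heq.symm
    have : c₁ = 0 := huniq c₁ z₁ (fun j => hz₁ j trivial)
      fun j => norm_eq_zero.1 (h0 j (Finset.mem_univ j))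
    rw [this] at hc₁
    simp at hc₁
  · rcases eq_or_ne c 0 with rfl | hc
    · simp
    have hcn : (0 : ℝ) < ‖c‖ := norm_pos_iff.2 hc
    have hmem : (((‖c‖⁻¹ : ℝ) : ℂ) • c, z) ∈ S :=
      ⟨by simp [norm_smul, hcn.ne'], fun j _ => hz j⟩
    have := hmin hmem
    simp only [mem_ofPred_eq, Pi.smul_apply, smul_eq_mul, mul_assoc, ← Finset.mul_sum,
      norm_mul, Complex.norm_real, norm_inv, norm_norm] at this
    rwa [inv_mul_eq_div, le_div_iff₀ hcn] at this

/-- Intervals of length `ρ` are placed at step `(1 + ρ) / 2`. This exceeds `ρ`, so they are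
disjoint, and is below `1`, so their number outgrows the number of cells they occupy by any
prescribed amount. -/
lemma exists_window {ρ : ℝ} (hρ0 : 0 ≤ ρ) (hρ : ρ < 1) (n : ℕ) :
    ∃ N Q : ℕ, 0 < N ∧ N + n ≤ Q ∧ ((Q : ℝ) + 1) * ((1 + ρ) / 2) + ρ < N := by
  have h1 : 0 < 1 - (1 + ρ) / 2 := by linarith
  -- Of `n + 3`, one unit pays for the ceiling and two for the `Q + 2` in place of `Q`.
  obtain ⟨Q, hQ⟩ := exists_nat_ge ((n + 3) / (1 - (1 + ρ) / 2))
  rw [div_le_iff₀ h1] at hQ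
  have hpos : 0 < ((Q : ℝ) + 2) * ((1 + ρ) / 2) := by positivity
  refine ⟨⌈((Q : ℝ) + 2) * ((1 + ρ) / 2)⌉₊, Q, Nat.ceil_pos.2 hpos, ?_, ?_⟩
  · have := (Nat.ceil_lt_add_one hpos.le)
    have : ((⌈((Q : ℝ) + 2) * ((1 + ρ) / 2)⌉₊ + n : ℕ) : ℝ) ≤ Q := by
      push_cast
      linarith
    exact_mod_cast this
  · refine lt_of_lt_of_le ?_ (Nat.le_ceil _)
    linarith

lemma IsGenerator.local_bound_succ (h : IsGenerator w (n + 1) ψ) {ρ : ℝ} (hρ0 : 0 ≤ ρ)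
    (hρ : ρ < 1) : ∃ (N : ℕ) (C : ℝ), 0 < C ∧ ∀ (c : ℤ → ℂ) (Y : Set ℝ),
      (∀ t : ℝ, ∃ y ∈ Y, y ∈ Icc t (t + ρ)) → ∀ ε : ℝ, (∀ y ∈ Y, y ∈ Ico (0 : ℝ) N →
        ‖∑ l ∈ Finset.Ico (-((n + 1 : ℕ) : ℤ)) N, c l * ψ (y - l)‖ ≤ ε) → ‖c 0‖ ≤ C * ε := by
  obtain ⟨N, Q, hN, hQ, hNQ⟩ := exists_window hρ0 hρ n
  set I := Finset.Ico (-((n + 1 : ℕ) : ℤ)) N with hI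
  have hI0 : (0 : ℤ) ∈ I := Finset.mem_Ico.2 ⟨by omega, by omega⟩
  have : Nonempty I := ⟨⟨0, hI0⟩⟩
  -- Left endpoints of two families of intervals of length `ρ`: spaced ones that provide many
  -- distinct zeros, and one centred in each cell.
  let τ : Fin (Q + 2) ⊕ Fin N → ℝ :=
    Sum.elim (fun i => (i : ℝ) * ((1 + ρ) / 2)) (fun i => (i : ℝ) + (1 - ρ) / 2)
  have hτ : ∀ j, ∀ y ∈ Icc (τ j) (τ j + ρ), y ∈ Ico (0 : ℝ) N := by
    rintro (i | i) y ⟨h1, h2⟩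
    · have hi : (i : ℝ) ≤ Q + 1 := by exact_mod_cast (by omega : (i : ℕ) ≤ Q + 1)
      have : (i : ℝ) * ((1 + ρ) / 2) ≤ (Q + 1) * ((1 + ρ) / 2) :=
        mul_le_mul_of_nonneg_right hi (by linarith)
      have h3 : 0 ≤ (i : ℝ) * ((1 + ρ) / 2) := by positivity
      simp only [τ, Sum.elim_inl] at h1 h2
      exact ⟨by linarith, by linarith⟩
    · have hi : (i : ℝ) + 1 ≤ N := by exact_mod_cast i.2
      have h3 : (0 : ℝ) ≤ (i : ℕ) := by positivity
      simp only [τ, Sum.elim_inr] at h1 h2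
      exact ⟨by linarith, by linarith⟩
  obtain ⟨δ, hδ, hbound⟩ := exists_lower_bound (ι := I) (fun j => Icc (τ j) (τ j + ρ))
    (fun _ => isCompact_Icc) (fun l x => ψ (x - (l : ℤ)))
    (fun l => h.continuous.comp (continuous_id.sub continuous_const)) (by
      intro c z hz h0
      let c' : ℤ → ℂ := fun l => if hl : l ∈ I then c ⟨l, hl⟩ else 0
      have hsum : ∀ x : ℝ, ∑ l ∈ I, c' l * ψ (x - l) = ∑ l : I, c l * ψ (x - (l : ℤ)) :=
        fun x => by
          rw [← Finset.sum_coe_sort]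
          exact Finset.sum_congr rfl fun l _ => by simp [c']
      have := h.coeff_eq_zero_of_zeros hN hQ c'
        (fun i => if hi : i < Q + 2 then z (.inl ⟨i, hi⟩) else 0)
        (fun i hi => by
          rw [dif_pos (by omega : i < Q + 2)]
          exact hτ _ _ (hz _))
        (fun i hi => by
          simp only [dif_pos (by omega : i < Q + 2), dif_pos (by omega : i + 1 < Q + 2)]
          have h1 := (hz (.inl ⟨i, by omega⟩)).2
          have h2 := (hz (.inl ⟨i + 1, by omega⟩)).1
          simp only [τ, Sum.elim_inl] at h1 h2
          push_cast at h1 h2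
          linarith)
        (fun i hi => by
          simp only [dif_pos (by omega : i < Q + 2)]
          rw [hsum, h0])
        (fun i hi => by
          refine ⟨z (.inr ⟨i, hi⟩), ?_, by rw [hsum, h0]⟩
          have h1 := hz (.inr ⟨i, hi⟩)
          simp only [τ, Sum.elim_inr] at h1
          exact ⟨by linarith [h1.1], by linarith [h1.2]⟩)
      ext ⟨l, hl⟩
      simpa [c', hl] using this l hl)
  set M : ℝ := (Fintype.card (Fin (Q + 2) ⊕ Fin N) : ℝ) with hM
  have hMpos : 0 < M := by
    rw [hM]; exact_mod_cast Fintype.card_pos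
  refine ⟨N, M / δ, by positivity, fun c Y hY ε hε => ?_⟩
  choose z hzY hz using fun j => hY (τ j)
  have h1 := hbound (fun l => c l) z hz
  have h2 : ∑ j, ‖∑ l : I, c l * ψ (z j - (l : ℤ))‖ ≤ M * ε := by
    refine (Finset.sum_le_card_nsmul _ _ ε fun j _ => ?_).trans_eq (by simp [hM])
    have := hε (z j) (hzY j) (hτ j _ (hz j))
    rwa [← Finset.sum_coe_sort] at this
  have h3 : ‖c 0‖ ≤ ‖fun l : I => c l‖ := norm_le_pi_norm (fun l : I => c l) ⟨0, hI0⟩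
  rw [div_mul_eq_mul_div, le_div_iff₀ hδ]
  calc ‖c 0‖ * δ ≤ ‖fun l : I => c l‖ * δ := by gcongr
    _ ≤ M * ε := by rw [mul_comm]; exact h1.trans h2

/-- The generator may jump, so the compactness argument does not apply. Here the window `[0, 1)`
meets one shift only and contains a sample, at which the weight is bounded below. -/
lemma IsGenerator.local_bound_zero (h : IsGenerator w 0 ψ) {ρ : ℝ} (hρ : ρ < 1) :
    ∃ (N : ℕ) (C : ℝ), 0 < C ∧ ∀ (c : ℤ → ℂ) (Y : Set ℝ),
      (∀ t : ℝ, ∃ y ∈ Y, y ∈ Icc t (t + ρ)) → ∀ ε : ℝ, (∀ y ∈ Y, y ∈ Ico (0 : ℝ) N →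
        ‖∑ l ∈ Finset.Ico (-((0 : ℕ) : ℤ)) N, c l * ψ (y - l)‖ ≤ ε) → ‖c 0‖ ≤ C * ε := by
  have h0 := h.isCSpline 0
  simp only [Int.cast_zero, sub_zero] at h0
  obtain ⟨⟨c₁, hc₁⟩, ⟨c₂, hc₂⟩⟩ := h0
  set α : ℂ := ⟨c₁ 0, c₂ 0⟩
  have hψ : ∀ x ∈ Ico (0 : ℝ) 1, ψ x = w 1 x * α := fun x hx => by
    have : ⌊x⌋ = 0 := Int.floor_eq_zero_iff.2 hx
    have e1 := hc₁ x
    have e2 := hc₂ x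
    rw [this] at e1 e2
    exact Complex.ext (by simp [α, e1]) (by simp [α, e2])
  have hα : α ≠ 0 := fun hα => by
    obtain ⟨x, hx, hne⟩ := h.ne_zero
    exact hne (by rw [hψ x hx, hα, mul_zero])
  obtain ⟨x₀, -, hmin⟩ := isCompact_Icc.exists_isMinOn (nonempty_Icc.2 zero_le_one)
    (h.posWeights.head.1.continuousOn (s := Icc (0 : ℝ) 1))
  have hx₀ := h.posWeights.head.2 x₀
  have hα' : 0 < ‖α‖ := norm_pos_iff.2 hα
  refine ⟨1, (w 1 x₀ * ‖α‖)⁻¹, by positivity, fun c Y hY ε hε => ?_⟩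
  obtain ⟨y, hyY, hy⟩ := hY 0
  have hy' : y ∈ Ico (0 : ℝ) 1 := ⟨hy.1, by linarith [hy.2]⟩
  have h1 := hε y hyY (by simpa using hy')
  have h2 : w 1 x₀ ≤ w 1 y := hmin ⟨hy'.1, hy'.2.le⟩
  have hI : Finset.Ico (-((0 : ℕ) : ℤ)) (1 : ℕ) = {0} := rfl
  rw [hI, Finset.sum_singleton, Int.cast_zero, sub_zero, hψ y hy', norm_mul, norm_mul,
    Complex.norm_real, Real.norm_of_nonneg (h.posWeights.head.2 y).le] at h1
  rw [inv_mul_eq_div, le_div_iff₀ (by positivity)]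
  refine le_trans ?_ h1
  gcongr

/-- A coefficient is controlled by the samples in a window, uniformly in the sampling set. -/
theorem IsGenerator.local_bound (h : IsGenerator w n ψ) {ρ : ℝ} (hρ0 : 0 ≤ ρ) (hρ : ρ < 1) :
    ∃ (N : ℕ) (C : ℝ), 0 < C ∧ ∀ (c : ℤ → ℂ) (Y : Set ℝ),
      (∀ t : ℝ, ∃ y ∈ Y, y ∈ Icc t (t + ρ)) → ∀ ε : ℝ, (∀ y ∈ Y, y ∈ Ico (0 : ℝ) N →
        ‖∑ l ∈ Finset.Ico (-(n : ℤ)) N, c l * ψ (y - l)‖ ≤ ε) → ‖c 0‖ ≤ C * ε := by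
  cases n with
  | zero => exact h.local_bound_zero hρ
  | succ n => exact h.local_bound_succ hρ0 hρ

end Local

section Global

/-! ### Sums and integrals with a banded kernel -/

/-- Interchange of summation. Only one marginal of the kernel has to be bounded, because it is
applied to quantities already raised to the power `P`. -/
lemma tsum_le_of_kernel {ι κ : Type*} (a : ι → ℝ≥0∞) (b : κ → ℝ≥0∞) (r : ι → κ → ℝ≥0∞)
    (C M : ℝ≥0∞) (ha : ∀ i, a i ≤ C * ∑' k, r i k * b k) (hr : ∀ k, ∑' i, r i k ≤ M) :
    ∑' i, a i ≤ C * M * ∑' k, b k :=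
  calc ∑' i, a i ≤ ∑' i, C * ∑' k, r i k * b k := ENNReal.tsum_le_tsum ha
    _ = C * ∑' k, (∑' i, r i k) * b k := by
        rw [ENNReal.tsum_mul_left, ENNReal.tsum_comm]
        simp_rw [ENNReal.tsum_mul_right]
    _ ≤ C * ∑' k, M * b k := by gcongr with k; exact hr k
    _ = C * M * ∑' k, b k := by rw [ENNReal.tsum_mul_left, mul_assoc]

lemma tsum_indicator_one_le {ι : Type*} (p : ι → Prop) [DecidablePred p] (S : Finset ι)
    (h : ∀ i, p i → i ∈ S) : ∑' i, (if p i then (1 : ℝ≥0∞) else 0) ≤ S.card := by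
  rw [tsum_eq_sum (s := S) fun i hi => if_neg fun hp => hi (h i hp)]
  refine (Finset.sum_le_card_nsmul S _ 1 fun i _ => ?_).trans (by simp)
  split_ifs <;> simp

lemma tsum_lintegral_shift (g : ℝ → ℝ≥0∞) {h : ℝ} (hh : 0 < h) :
    ∑' i : ℤ, ∫⁻ t in Ico 0 h, g (t + i * h) = ∫⁻ t, g t := by
  have h1 : ∀ i : ℤ, ∫⁻ t in Ico 0 h, g (t + i * h) = ∫⁻ t in Ico (i • h) ((i + 1) • h), g t :=
    fun i => by
      have hset : Ico 0 h = (fun t => t + (i : ℝ) * h) ⁻¹' Ico (i • h) ((i + 1) • h) := by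
        ext t
        simp only [mem_Ico, mem_preimage, zsmul_eq_mul]
        push_cast
        constructor <;> rintro ⟨h1, h2⟩ <;> constructor <;> linarith
      rw [hset]
      exact (measurePreserving_add_right volume ((i : ℝ) * h)).setLIntegral_comp_preimage_emb
        (measurableEmbedding_addRight _) g _
  simp_rw [h1]
  rw [← lintegral_iUnion (fun i => measurableSet_Ico), iUnion_Ico_zsmul hh, setLIntegral_univ]
  exact Set.pairwise_disjoint_Ico_zsmul h

/-! ### Sampling sequences -/

lemma add_mul_le_of_separated {x : ℤ → ℝ} {δ : ℝ} (hδ : ∀ i, x i + δ ≤ x (i + 1)) (i : ℤ)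
    (d : ℕ) : x i + d * δ ≤ x (i + d) := by
  induction d with
  | zero => simp
  | succ d ih =>
    have := hδ (i + d)
    push_cast
    rw [← add_assoc]
    linarith

lemma exists_greatest_lt {x : ℤ → ℝ} (hx : StrictMono x) {δ : ℝ} (hδ0 : 0 < δ)
    (hδ : ∀ i, x i + δ ≤ x (i + 1)) (t : ℝ) : ∃ i, x i < t ∧ ∀ j, x j < t → j ≤ i := by
  refine Int.exists_greatest_of_bdd ?_ ?_
  · obtain ⟨d, hd⟩ := exists_nat_gt ((t - x 0) / δ)
    rw [div_lt_iff₀ hδ0] at hd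
    refine ⟨d, fun z hz => ?_⟩
    by_contra! hlt
    have h1 := add_mul_le_of_separated hδ 0 d
    rw [zero_add] at h1
    linarith [hx hlt]
  · obtain ⟨d, hd⟩ := exists_nat_gt ((x 0 - t) / δ)
    rw [div_lt_iff₀ hδ0] at hd
    refine ⟨-d, ?_⟩
    have h1 := add_mul_le_of_separated hδ (-d) d
    rw [neg_add_cancel] at h1
    linarith

lemma exists_mem_Icc_of_gap {x : ℤ → ℝ} (hx : StrictMono x) {δ ρ : ℝ} (hδ0 : 0 < δ)
    (hδ : ∀ i, x i + δ ≤ x (i + 1)) (hρ : ∀ i, x (i + 1) ≤ x i + ρ) (t : ℝ) :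
    ∃ y ∈ range x, y ∈ Icc t (t + ρ) := by
  obtain ⟨i, hi, hmax⟩ := exists_greatest_lt hx hδ0 hδ t
  refine ⟨x (i + 1), mem_range_self _, ?_, by linarith [hρ i]⟩
  by_contra! hlt
  have := hmax _ hlt
  omega

lemma exists_finset_of_separated {x : ℤ → ℝ} (hx : StrictMono x) {δ : ℝ} (hδ0 : 0 < δ)
    (hδ : ∀ i, x i + δ ≤ x (i + 1)) (L : ℝ) : ∃ M : ℕ, ∀ t : ℝ, ∃ S : Finset ℤ, S.card ≤ M ∧
      ∀ i, x i ∈ Ico t (t + L) → i ∈ S := by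
  obtain ⟨d, hd⟩ := exists_nat_gt (L / δ)
  rw [div_lt_iff₀ hδ0] at hd
  refine ⟨d, fun t => ?_⟩
  obtain ⟨i₀, hi₀, hmax⟩ := exists_greatest_lt hx hδ0 hδ t
  refine ⟨Finset.Ioc i₀ (i₀ + d), by simp, fun i hi => Finset.mem_Ioc.2 ⟨?_, ?_⟩⟩
  · by_contra! hle
    have := hx.monotone hle
    linarith [hi.1]
  · by_contra! hlt
    have h1 := add_mul_le_of_separated hδ (i₀ + 1) d
    have h2 : t ≤ x (i₀ + 1) := by
      by_contra! h
      have := hmax _ h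
      omega
    have h3 : x (i₀ + 1 + d) ≤ x i := hx.monotone (by omega)
    linarith [hi.2]

/-! ### Global estimates -/

variable {w : ℕ → ℝ → ℝ} {n : ℕ} {ψ : ℝ → ℂ}

lemma IsGenerator.exists_bound (h : IsGenerator w n ψ) : ∃ B : ℝ≥0, ∀ x, ‖ψ x‖ₑ ≤ B := by
  have h0 := h.isCSpline 0
  simp only [Int.cast_zero, sub_zero] at h0
  obtain ⟨C, hC⟩ := h0.1.exists_bound h.posWeights 0 (n + 1)
  obtain ⟨D, hD⟩ := h0.2.exists_bound h.posWeights 0 (n + 1)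
  refine ⟨(C + D).toNNReal, fun x => ?_⟩
  by_cases hx : x ∈ Icc (0 : ℝ) (n + 1)
  · rw [← ofReal_norm]
    exact ENNReal.ofReal_le_ofReal ((Complex.norm_le_abs_re_add_abs_im _).trans
      (add_le_add (hC x hx) (hD x hx)))
  · rw [mem_Icc, not_and_or, not_le, not_le] at hx
    rcases hx with hx | hx
    · simp [h.zero_left x hx]
    · simp [h.zero_right x hx.le]

lemma IsGenerator.enorm_le_sum (h : IsGenerator w n ψ) {B : ℝ≥0} (hB : ∀ x, ‖ψ x‖ₑ ≤ B)
    {c : ℤ → ℂ} {f : ℝ → ℂ} (hf : ∀ x, HasSum (fun l : ℤ => c l * ψ (x - l)) (f x)) (y : ℝ) :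
    ‖f y‖ₑ ≤ B * ∑ l ∈ Finset.Icc (⌊y⌋ - n) ⌊y⌋, ‖c l‖ₑ := by
  have h1 : f y = ∑ l ∈ Finset.Icc (⌊y⌋ - n) ⌊y⌋, c l * ψ (y - l) := by
    refine (hf y).unique (hasSum_sum_of_ne_finset_zero fun l hl => ?_)
    rw [Finset.mem_Icc, not_and_or, not_le, not_le] at hl
    rcases hl with hlt | hgt
    · have : (l : ℝ) + 1 ≤ ⌊y⌋ - n := by exact_mod_cast hlt
      rw [h.zero_right _ (by linarith [Int.floor_le y]), mul_zero]
    · have : (⌊y⌋ : ℝ) + 1 ≤ l := by exact_mod_cast hgt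
      rw [h.zero_left _ (by linarith [Int.lt_floor_add_one y]), mul_zero]
  rw [h1, Finset.mul_sum]
  refine (enorm_sum_le _ _).trans (Finset.sum_le_sum fun l _ => ?_)
  rw [enorm_mul, mul_comm]
  gcongr
  exact hB _

lemma IsGenerator.enorm_rpow_le (h : IsGenerator w n ψ) {P : ℝ} (hP : 1 ≤ P) :
    ∃ D : ℝ≥0, ∀ (c : ℤ → ℂ) (f : ℝ → ℂ),
      (∀ x, HasSum (fun l : ℤ => c l * ψ (x - l)) (f x)) → ∀ y,
      ‖f y‖ₑ ^ P ≤ D * ∑' l : ℤ, (if y ∈ Ico (l : ℝ) (l + (n + 1)) then 1 else 0) * ‖c l‖ₑ ^ P := by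
  obtain ⟨B, hB⟩ := h.exists_bound
  have hP0 : 0 ≤ P := by linarith
  -- The second factor is the power mean constant for the `n + 1` shifts active at a point.
  refine ⟨B ^ P * ((n + 1 : ℕ) : ℝ≥0) ^ (P - 1), fun c f hf y => ?_⟩
  have hcard : (Finset.Icc (⌊y⌋ - n) ⌊y⌋).card = n + 1 := by
    rw [Int.card_Icc]; omega
  calc ‖f y‖ₑ ^ P ≤ (B * ∑ l ∈ Finset.Icc (⌊y⌋ - n) ⌊y⌋, ‖c l‖ₑ) ^ P :=
        ENNReal.rpow_le_rpow (h.enorm_le_sum hB hf y) hP0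
    _ ≤ B ^ P * (((n + 1 : ℕ) : ℝ≥0∞) ^ (P - 1) *
          ∑ l ∈ Finset.Icc (⌊y⌋ - n) ⌊y⌋, ‖c l‖ₑ ^ P) := by
        rw [ENNReal.mul_rpow_of_nonneg _ _ hP0, ← hcard]
        gcongr
        exact ENNReal.rpow_sum_le_const_mul_sum_rpow _ _ hP
    _ ≤ _ := by
        rw [ENNReal.coe_mul, ENNReal.coe_rpow_of_nonneg _ hP0,
          ENNReal.coe_rpow_of_nonneg _ (by linarith : 0 ≤ P - 1), ENNReal.coe_natCast, mul_assoc]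
        gcongr
        refine (Finset.sum_congr rfl fun l hl => ?_).trans_le (ENNReal.sum_le_tsum _)
        rw [Finset.mem_Icc] at hl
        have h1 : (l : ℝ) ≤ ⌊y⌋ := by exact_mod_cast hl.2
        have h2 : (⌊y⌋ : ℝ) - n ≤ l := by exact_mod_cast hl.1
        rw [if_pos ⟨h1.trans (Int.floor_le y), by linarith [Int.lt_floor_add_one y]⟩, one_mul]

/-- Translation by `j` reduces `c j` to `c 0`. The translated set still meets every interval of
length `ρ`, and the local bound is uniform over such sets, so `N` and `C` serve all `j`. -/
lemma IsGenerator.coeff_le (h : IsGenerator w n ψ) {ρ : ℝ} (hρ0 : 0 ≤ ρ) (hρ : ρ < 1) :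
    ∃ (N : ℕ) (C : ℝ≥0), 0 < C ∧ ∀ (c : ℤ → ℂ) (f : ℝ → ℂ),
      (∀ x, HasSum (fun l : ℤ => c l * ψ (x - l)) (f x)) → ∀ Y : Set ℝ,
      (∀ t : ℝ, ∃ y ∈ Y, y ∈ Icc t (t + ρ)) → ∀ (j : ℤ) (ε : ℝ≥0∞),
      (∀ y ∈ Y, y ∈ Ico (j : ℝ) (j + N) → ‖f y‖ₑ ≤ ε) → ‖c j‖ₑ ≤ C * ε := by
  obtain ⟨N, C, hC, hloc⟩ := h.local_bound hρ0 hρ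
  refine ⟨N, C.toNNReal, by simpa using hC, fun c f hf Y hY j ε hε => ?_⟩
  rcases eq_or_ne ε ∞ with rfl | htop
  · rw [ENNReal.mul_top (by simpa using hC)]; exact le_top
  have hval : ∀ y ∈ Ico (0 : ℝ) N,
      ∑ l ∈ Finset.Ico (-(n : ℤ)) N, c (j + l) * ψ (y - l) = f (j + y) := fun y hy => by
    have h1 : HasSum (fun l : ℤ => c (j + l) * ψ (y - l)) (f (j + y)) := by
      refine ((Equiv.addLeft j).hasSum_iff.2 (hf (j + y))).congr_fun ?_
      intro l
      simp
    refine HasSum.unique (hasSum_sum_of_ne_finset_zero fun l hl => ?_) h1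
    rw [Finset.mem_Ico, not_and_or, not_le, not_lt] at hl
    rcases hl with hlt | hge
    · have : (l : ℝ) + 1 ≤ -n := by exact_mod_cast hlt
      rw [h.zero_right _ (by linarith [hy.1]), mul_zero]
    · have : (N : ℝ) ≤ l := by exact_mod_cast hge
      rw [h.zero_left _ (by linarith [hy.2]), mul_zero]
  have key := hloc (fun l => c (j + l)) ((fun y => y - (j : ℝ)) '' Y) (fun t => by
    obtain ⟨y, hy, hyt⟩ := hY (t + j)
    exact ⟨y - j, mem_image_of_mem _ hy, by linarith [hyt.1], by linarith [hyt.2]⟩) ε.toReal (by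
    rintro _ ⟨y, hy, rfl⟩ hyN
    rw [hval _ hyN, add_sub_cancel]
    have := ENNReal.toReal_mono htop (hε y hy ⟨by linarith [hyN.1], by linarith [hyN.2]⟩)
    simpa using this)
  simp only [add_zero] at key
  rw [← ofReal_norm, ← ENNReal.ofReal_toReal htop]
  refine (ENNReal.ofReal_le_ofReal key).trans_eq ?_
  rw [ENNReal.ofReal_mul hC.le]
  rfl

lemma IsGenerator.tsum_coeff_le (h : IsGenerator w n ψ) {ρ : ℝ} (hρ0 : 0 ≤ ρ) (hρ : ρ < 1)
    {P : ℝ} (hP : 1 ≤ P) : ∃ K : ℝ≥0, ∀ (c : ℤ → ℂ) (f : ℝ → ℂ),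
      (∀ x, HasSum (fun l : ℤ => c l * ψ (x - l)) (f x)) → ∀ x : ℤ → ℝ,
      (∀ t : ℝ, ∃ y ∈ range x, y ∈ Icc t (t + ρ)) →
      ∑' l, ‖c l‖ₑ ^ P ≤ K * ∑' i, ‖f (x i)‖ₑ ^ P := by
  obtain ⟨N, C, hC, hcoeff⟩ := h.coeff_le hρ0 hρ
  have hP0 : 0 < P := by linarith
  refine ⟨C ^ P * (N + 1 : ℕ), fun c f hf x hx => ?_⟩
  rw [ENNReal.coe_mul, ENNReal.coe_rpow_of_nonneg _ hP0.le, ENNReal.coe_natCast]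
  refine tsum_le_of_kernel _ _
    (fun (j : ℤ) i => if x i ∈ Ico (j : ℝ) (j + N) then 1 else 0) _ _ (fun j => ?_) (fun i => ?_)
  -- The supremum over a window is bounded by its `ℓ^P` norm; each sample lies in at most `N + 1`
  -- windows.
  · have := hcoeff c f hf (range x) hx j ((∑' i, (if x i ∈ Ico (j : ℝ) (j + N) then 1 else 0) *
      ‖f (x i)‖ₑ ^ P) ^ (1 / P)) (by
      rintro _ ⟨i, rfl⟩ hi
      rw [one_div, ENNReal.le_rpow_inv_iff hP0]
      refine le_trans ?_ (ENNReal.le_tsum i)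
      rw [if_pos hi, one_mul])
    refine (ENNReal.rpow_le_rpow this hP0.le).trans_eq ?_
    rw [ENNReal.mul_rpow_of_nonneg _ _ hP0.le, ← ENNReal.rpow_mul, one_div,
      inv_mul_cancel₀ hP0.ne', ENNReal.rpow_one]
  · refine (tsum_indicator_one_le _ (Finset.Icc (⌊x i⌋ - N) ⌊x i⌋) fun j hj => ?_).trans_eq ?_
    · refine Finset.mem_Icc.2 ⟨?_, Int.le_floor.2 hj.1⟩
      have : ((⌊x i⌋ : ℤ) : ℝ) < j + N := (Int.floor_le _).trans_lt hj.2
      have : ⌊x i⌋ < j + N := by exact_mod_cast this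
      omega
    · rw [Int.card_Icc]
      congr 1
      omega

lemma IsGenerator.tsum_samples_le (h : IsGenerator w n ψ) {P : ℝ} (hP : 1 ≤ P) {x : ℤ → ℝ}
    (hx : StrictMono x) {δ : ℝ} (hδ0 : 0 < δ) (hδ : ∀ i, x i + δ ≤ x (i + 1)) :
    ∃ K : ℝ≥0, ∀ (c : ℤ → ℂ) (f : ℝ → ℂ),
      (∀ x, HasSum (fun l : ℤ => c l * ψ (x - l)) (f x)) →
      ∑' i, ‖f (x i)‖ₑ ^ P ≤ K * ∑' l, ‖c l‖ₑ ^ P := by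
  obtain ⟨D, hD⟩ := h.enorm_rpow_le hP
  obtain ⟨M, hM⟩ := exists_finset_of_separated hx hδ0 hδ (n + 1)
  refine ⟨D * M, fun c f hf => ?_⟩
  rw [ENNReal.coe_mul, ENNReal.coe_natCast]
  refine tsum_le_of_kernel _ _ _ _ _ (fun i => hD c f hf (x i)) fun l => ?_
  obtain ⟨S, hS, hmem⟩ := hM l
  exact (tsum_indicator_one_le _ S hmem).trans (by exact_mod_cast hS)

lemma IsGenerator.lintegral_le (h : IsGenerator w n ψ) {P : ℝ} (hP : 1 ≤ P) :
    ∃ K : ℝ≥0, ∀ (c : ℤ → ℂ) (f : ℝ → ℂ),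
      (∀ x, HasSum (fun l : ℤ => c l * ψ (x - l)) (f x)) →
      ∫⁻ y, ‖f y‖ₑ ^ P ≤ K * ∑' l, ‖c l‖ₑ ^ P := by
  obtain ⟨D, hD⟩ := h.enorm_rpow_le hP
  refine ⟨D * (n + 1 : ℕ), fun c f hf => ?_⟩
  have hmeas : ∀ l : ℤ, Measurable fun y : ℝ =>
      (if y ∈ Ico (l : ℝ) (l + (n + 1)) then (1 : ℝ≥0∞) else 0) := fun l =>
    Measurable.ite measurableSet_Ico measurable_const measurable_const
  have hint : ∀ l : ℤ, ∫⁻ y : ℝ, (if y ∈ Ico (l : ℝ) (l + (n + 1)) then (1 : ℝ≥0∞) else 0) =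
      (n + 1 : ℕ) := fun l => by
    have := lintegral_indicator_one (μ := (volume : Measure ℝ))
      (measurableSet_Ico (a := (l : ℝ)) (b := l + (n + 1)))
    rw [Real.volume_Ico, add_sub_cancel_left] at this
    have e : ENNReal.ofReal ((n : ℝ) + 1) = (n + 1 : ℕ) := by
      rw [← ENNReal.ofReal_natCast]; push_cast; rfl
    rw [← e, ← this]
    exact lintegral_congr fun y => by simp [indicator_apply]
  calc ∫⁻ y, ‖f y‖ₑ ^ P ≤ ∫⁻ y, D * ∑' l : ℤ,
        (if y ∈ Ico (l : ℝ) (l + (n + 1)) then 1 else 0) * ‖c l‖ₑ ^ P :=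
        lintegral_mono fun y => hD c f hf y
    _ = D * ∑' l : ℤ, (n + 1 : ℕ) * ‖c l‖ₑ ^ P := by
        rw [lintegral_const_mul' _ _ ENNReal.coe_ne_top,
          lintegral_tsum fun l => ((hmeas l).mul_const _).aemeasurable]
        congr 2
        ext l
        rw [lintegral_mul_const _ (hmeas l), hint]
    _ = _ := by
        rw [ENNReal.tsum_mul_left, ENNReal.coe_mul, ENNReal.coe_natCast, mul_assoc]

lemma exists_half_shift_mem_Icc (s : ℝ) {ρ : ℝ} (hρ : 1 / 2 ≤ ρ) (t : ℝ) :
    ∃ y ∈ range (fun i : ℤ => s + i * (1 / 2)), y ∈ Icc t (t + ρ) := by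
  refine ⟨_, ⟨⌈2 * (t - s)⌉, rfl⟩, ?_, ?_⟩
  · have := Int.le_ceil (2 * (t - s))
    simp only; linarith
  · have := Int.ceil_lt_add_one (2 * (t - s))
    simp only; linarith

/-- Each lattice `t + ℤ/2` has gap below `1`, so its samples bound the coefficients with a constant
independent of `t`. Integration over `t ∈ [0, 1/2)` turns the sums of samples into the integral over
the line. -/
lemma IsGenerator.tsum_coeff_le_lintegral (h : IsGenerator w n ψ) {P : ℝ} (hP : 1 ≤ P) :
    ∃ K : ℝ≥0, ∀ (c : ℤ → ℂ) (f : ℝ → ℂ), AEStronglyMeasurable f volume →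
      (∀ x, HasSum (fun l : ℤ => c l * ψ (x - l)) (f x)) →
      ∑' l, ‖c l‖ₑ ^ P ≤ K * ∫⁻ y, ‖f y‖ₑ ^ P := by
  obtain ⟨K, hK⟩ := h.tsum_coeff_le (ρ := 1 / 2) (by norm_num) (by norm_num) hP
  refine ⟨2 * K, fun c f hfm hf => ?_⟩
  have hm : ∀ i : ℤ, AEMeasurable (fun t : ℝ => ‖f (t + i * (1 / 2))‖ₑ ^ P)
      (volume.restrict (Ico 0 (1 / 2))) := fun i =>
    ((hfm.comp_quasiMeasurePreserving (measurePreserving_add_right volume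
      ((i : ℝ) * (1 / 2))).quasiMeasurePreserving).enorm.pow_const P).restrict
  have h1 : ENNReal.ofReal (1 / 2) * ∑' l, ‖c l‖ₑ ^ P ≤ K * ∫⁻ y, ‖f y‖ₑ ^ P :=
    calc ENNReal.ofReal (1 / 2) * ∑' l, ‖c l‖ₑ ^ P
        = ∫⁻ _ in Ico (0 : ℝ) (1 / 2), ∑' l, ‖c l‖ₑ ^ P := by
          rw [setLIntegral_const, Real.volume_Ico, sub_zero, mul_comm]
      _ ≤ ∫⁻ t in Ico (0 : ℝ) (1 / 2), K * ∑' i : ℤ, ‖f (t + i * (1 / 2))‖ₑ ^ P :=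
          lintegral_mono fun t => hK c f hf _ (exists_half_shift_mem_Icc t le_rfl)
      _ = K * ∫⁻ y, ‖f y‖ₑ ^ P := by
          rw [lintegral_const_mul' _ _ ENNReal.coe_ne_top, lintegral_tsum hm,
            tsum_lintegral_shift (fun y => ‖f y‖ₑ ^ P) (by norm_num)]
  calc ∑' l, ‖c l‖ₑ ^ P = 2 * (ENNReal.ofReal (1 / 2) * ∑' l, ‖c l‖ₑ ^ P) := by
        rw [← mul_assoc, ← ENNReal.ofReal_ofNat 2, ← ENNReal.ofReal_mul (by norm_num)]
        norm_num
    _ ≤ 2 * (K * ∫⁻ y, ‖f y‖ₑ ^ P) := by gcongr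
    _ = _ := by rw [ENNReal.coe_mul, mul_assoc]; rfl

/-! ### Assembling the two-sided inequalities. -/

/-- Two-sided bounds by some constants, from upper bounds on each quantity. -/
lemma exists_pos_constants {α : Type*} (V : Set α) (F G : α → ℝ≥0∞) {K L : ℝ≥0}
    (hK : ∀ f ∈ V, F f ≤ K * G f) (hL : ∀ f ∈ V, G f ≤ L * F f) :
    ∃ A B : ℝ, 0 < A ∧ 0 < B ∧ ∀ f ∈ V,
      ENNReal.ofReal A * F f ≤ G f ∧ G f ≤ ENNReal.ofReal B * F f := by
  -- Adding one keeps the constants positive even if `K` or `L` is zero.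
  refine ⟨((K : ℝ) + 1)⁻¹, L + 1, by positivity, by positivity, fun f hf => ⟨?_, ?_⟩⟩
  · have e : ENNReal.ofReal ((K : ℝ) + 1)⁻¹ = ((K : ℝ≥0∞) + 1)⁻¹ := by
      rw [ENNReal.ofReal_inv_of_pos (by positivity), ENNReal.ofReal_add (by positivity) (by simp)]
      simp
    rw [e, mul_comm, ← div_eq_mul_inv]
    refine ENNReal.div_le_of_le_mul ?_
    rw [mul_comm]
    refine (hK f hf).trans ?_
    gcongr
    exact le_self_add
  · refine (hL f hf).trans ?_
    gcongr
    rw [ENNReal.ofReal_add (by positivity) (by simp)]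
    simp

lemma eLpNorm_rpow_toReal {p : ℝ≥0∞} (hp : 1 ≤ p) (htop : p ≠ ∞) (f : ℝ → ℂ) :
    eLpNorm f p volume ^ p.toReal = ∫⁻ y, ‖f y‖ₑ ^ p.toReal := by
  have hp0 : p ≠ 0 := (zero_lt_one.trans_le hp).ne'
  rw [eLpNorm_eq_lintegral_rpow_enorm_toReal hp0 htop, ← ENNReal.rpow_mul, one_div,
    inv_mul_cancel₀ (ENNReal.toReal_pos hp0 htop).ne', ENNReal.rpow_one]

lemma shiftInvariantSpace.exists_hasSum {p : ℝ≥0∞} {φ : ℝ → ℂ} (k : ℤ) {f : ℝ → ℂ}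
    (hf : f ∈ shiftInvariantSpace p φ) :
    ∃ c : ℤ → ℂ, ∀ x, HasSum (fun l : ℤ => c l * φ (x - l + k)) (f x) := by
  obtain ⟨-, c, -, hc⟩ := hf
  refine ⟨fun l => c (l - k), fun x => ?_⟩
  refine ((Equiv.subRight k).hasSum_iff.2 (hc x)).congr_fun fun l => ?_
  simp [sub_sub_eq_add_sub, add_sub_right_comm]

lemma IsGenerator.sampling_finite (h : IsGenerator w n ψ) {V : Set (ℝ → ℂ)}
    (hVm : ∀ f ∈ V, AEStronglyMeasurable f volume)
    (hV : ∀ f ∈ V, ∃ c : ℤ → ℂ, ∀ x, HasSum (fun l : ℤ => c l * ψ (x - l)) (f x)) {P : ℝ}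
    (hP : 1 ≤ P) {x : ℤ → ℝ} (hx : StrictMono x) {δ ρ : ℝ} (hδ0 : 0 < δ)
    (hδ : ∀ i, x i + δ ≤ x (i + 1)) (hρ0 : 0 ≤ ρ) (hρ1 : ρ < 1)
    (hρ : ∀ i, x (i + 1) ≤ x i + ρ) :
    ∃ A B : ℝ, 0 < A ∧ 0 < B ∧ ∀ f ∈ V,
      ENNReal.ofReal A * ∫⁻ y, ‖f y‖ₑ ^ P ≤ ∑' i, ‖f (x i)‖ₑ ^ P ∧
      ∑' i, ‖f (x i)‖ₑ ^ P ≤ ENNReal.ofReal B * ∫⁻ y, ‖f y‖ₑ ^ P := by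
  obtain ⟨K₁, hK₁⟩ := h.lintegral_le hP
  obtain ⟨K₂, hK₂⟩ := h.tsum_coeff_le hρ0 hρ1 hP
  obtain ⟨K₃, hK₃⟩ := h.tsum_samples_le hP hx hδ0 hδ
  obtain ⟨K₄, hK₄⟩ := h.tsum_coeff_le_lintegral hP
  refine exists_pos_constants V (fun f => ∫⁻ y, ‖f y‖ₑ ^ P) (fun f => ∑' i, ‖f (x i)‖ₑ ^ P)
    (K := K₁ * K₂) (L := K₃ * K₄) (fun f hf => ?_) (fun f hf => ?_)
  · obtain ⟨c, hc⟩ := hV f hf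
    rw [ENNReal.coe_mul, mul_assoc]
    refine (hK₁ c f hc).trans ?_
    gcongr
    exact hK₂ c f hc x (exists_mem_Icc_of_gap hx hδ0 hδ hρ)
  · obtain ⟨c, hc⟩ := hV f hf
    rw [ENNReal.coe_mul, mul_assoc]
    refine (hK₃ c f hc).trans ?_
    gcongr
    exact hK₄ c f (hVm f hf) hc

lemma IsGenerator.sampling_top (h : IsGenerator w n ψ) {V : Set (ℝ → ℂ)}
    (hV : ∀ f ∈ V, ∃ c : ℤ → ℂ, ∀ x, HasSum (fun l : ℤ => c l * ψ (x - l)) (f x)) {x : ℤ → ℝ}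
    (hx : StrictMono x) {δ ρ : ℝ} (hδ0 : 0 < δ) (hδ : ∀ i, x i + δ ≤ x (i + 1)) (hρ0 : 1 / 2 ≤ ρ)
    (hρ1 : ρ < 1) (hρ : ∀ i, x (i + 1) ≤ x i + ρ) :
    ∃ A B : ℝ, 0 < A ∧ 0 < B ∧ ∀ f ∈ V,
      ENNReal.ofReal A * eLpNorm f ∞ volume ≤ ⨆ i, ‖f (x i)‖ₑ ∧
      ⨆ i, ‖f (x i)‖ₑ ≤ ENNReal.ofReal B * eLpNorm f ∞ volume := by
  obtain ⟨D, hD⟩ := h.exists_bound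
  obtain ⟨N, C, -, hC⟩ := h.coeff_le (by linarith) hρ1
  have hval : ∀ (c : ℤ → ℂ) (f : ℝ → ℂ), (∀ x, HasSum (fun l : ℤ => c l * ψ (x - l)) (f x)) →
      ∀ ε : ℝ≥0∞, (∀ l, ‖c l‖ₑ ≤ C * ε) → ∀ y, ‖f y‖ₑ ≤ (D * (n + 1 : ℕ) * C : ℝ≥0) * ε :=
    fun c f hf ε hε y => by
      refine (h.enorm_le_sum hD hf y).trans ?_
      have hcard : (Finset.Icc (⌊y⌋ - n) ⌊y⌋).card = n + 1 := by
        rw [Int.card_Icc]; omega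
      have := Finset.sum_le_card_nsmul (Finset.Icc (⌊y⌋ - n) ⌊y⌋) (fun l => ‖c l‖ₑ) _
        fun l _ => hε l
      rw [hcard, nsmul_eq_mul] at this
      rw [ENNReal.coe_mul, ENNReal.coe_mul, ENNReal.coe_natCast, mul_assoc, mul_assoc]
      gcongr
  refine exists_pos_constants V (fun f => eLpNorm f ∞ volume) (fun f => ⨆ i, ‖f (x i)‖ₑ)
    (K := D * (n + 1 : ℕ) * C) (L := D * (n + 1 : ℕ) * C) (fun f hf => ?_) (fun f hf => ?_)
  · obtain ⟨c, hc⟩ := hV f hf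
    rw [eLpNorm_exponent_top]
    refine eLpNormEssSup_le_of_ae_enorm_bound (Filter.Eventually.of_forall ?_)
    refine hval c f hc _ fun l =>
      hC c f hc (range x) (exists_mem_Icc_of_gap hx hδ0 hδ hρ) l _ ?_
    rintro _ ⟨i, rfl⟩ -
    exact le_iSup (fun i => ‖f (x i)‖ₑ) i
  · obtain ⟨c, hc⟩ := hV f hf
    -- The samples may lie in the null set where the essential supremum is no bound. For almost
    -- every `t` the lattice `t + ℤ/2` avoids it; its samples bound the coefficients, and these
    -- bound `f` everywhere.
    have hae : ∀ᵐ t : ℝ, ∀ i : ℤ, ‖f (t + i * (1 / 2))‖ₑ ≤ eLpNorm f ∞ volume := by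
      rw [ae_all_iff, eLpNorm_exponent_top]
      exact fun i => (measurePreserving_add_right volume ((i : ℝ) * (1 / 2))
        ).quasiMeasurePreserving.ae ae_le_eLpNormEssSup
    obtain ⟨t, ht⟩ := hae.exists
    refine iSup_le fun i => hval c f hc _ (fun l =>
      hC c f hc _ (exists_half_shift_mem_Icc t hρ0) l _ ?_) (x i)
    rintro _ ⟨j, rfl⟩ -
    exact ht j

end Global

end PEB

theorem corollary4p4 (m : ℕ) (hm : 1 ≤ m) (φ : ℝ → ℂ) (hφ : PEB.IsPEBSpline m φ)
    (X : Set ℝ) (x : ℤ → ℝ) (hx : StrictMono x) (hX : X = Set.range x)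
    (hsep : PEB.IsSeparatedSet X) (hgap : PEB.maxGap x < 1)
    (p : ℝ≥0∞) (hp : 1 ≤ p) :
    PEB.IsSamplingSet p (PEB.shiftInvariantSpace p φ) X := by
  subst hX
  obtain ⟨n, rfl⟩ := Nat.exists_eq_add_of_le' hm
  obtain ⟨w, k, hψ⟩ := hφ.exists_isGenerator
  obtain ⟨δ, hδ0, hδ'⟩ := hsep
  have hδ : ∀ i, x i + δ ≤ x (i + 1) := fun i => by
    have hlt : x i < x (i + 1) := hx (by omega)
    have : δ ≤ |x (i + 1) - x i| := hδ' (mem_range_self (i + 1)) (mem_range_self i) hlt.ne'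
    rw [abs_of_pos (by linarith)] at this
    linarith
  have hgtop : PEB.maxGap x ≠ ∞ := (hgap.trans ENNReal.one_lt_top).ne
  -- At least `1 / 2`, so that for `p = ∞` one `ρ` serves both `X` and the half-integer lattices.
  set ρ : ℝ := max (PEB.maxGap x).toReal (1 / 2)
  have hρ1 : ρ < 1 := max_lt (by
    have := (ENNReal.toReal_lt_toReal hgtop ENNReal.one_ne_top).2 hgap
    simpa using this) (by norm_num)
  have hρ0 : 1 / 2 ≤ ρ := le_max_right _ _
  have hρ : ∀ i, x (i + 1) ≤ x i + ρ := fun i => by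
    have h1 : ENNReal.ofReal (x (i + 1) - x i) ≤ PEB.maxGap x :=
      le_iSup (fun j : ℤ => ENNReal.ofReal (x (j + 1) - x j)) i
    have h2 := (ENNReal.ofReal_le_iff_le_toReal hgtop).1 h1
    linarith [le_max_left (PEB.maxGap x).toReal (1 / 2 : ℝ)]
  have hV : ∀ f ∈ PEB.shiftInvariantSpace p φ, ∃ c : ℤ → ℂ, ∀ x,
      HasSum (fun l : ℤ => c l * φ (x - l + k)) (f x) := fun f hf =>
    PEB.shiftInvariantSpace.exists_hasSum k hf
  rcases eq_or_ne p ∞ with rfl | htop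
  · obtain ⟨A, B, hA, hB, hAB⟩ := hψ.sampling_top hV hx hδ0 hδ hρ0 hρ1 hρ
    refine ⟨A, B, hA, hB, fun f hf => ⟨fun h => absurd rfl h, fun _ => ?_⟩⟩
    have e : ⨆ y : range x, ‖f y‖ₑ = ⨆ i, ‖f (x i)‖ₑ :=
      iSup_range' (fun y => ‖f y‖ₑ) x
    rw [e]
    exact hAB f hf
  · obtain ⟨A, B, hA, hB, hAB⟩ := hψ.sampling_finite (P := p.toReal) (fun f hf => hf.1.1) hV
      (by simpa using ENNReal.toReal_mono htop hp) hx hδ0 hδ (by linarith) hρ1 hρ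
    refine ⟨A, B, hA, hB, fun f hf => ⟨fun _ => ?_, fun h => absurd h htop⟩⟩
    rw [PEB.eLpNorm_rpow_toReal hp htop, tsum_range (fun y => ‖f y‖ₑ ^ p.toReal) hx.injective]
    exact hAB f hf
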